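/- The min-choice preferential attachment trees $P_1, P_2, \dots$ are the random trees defined as follows. $P_1$ is the tree with a single edge. Given $P_{m}$, a tree with $m$ edges and vertices $v_1,\dots,v_{m+1}$, let $X^1$ and $X^2$ be two vertices of $P_m$ chosen independently (conditionally on $P_m$), each with law $\Pr[X^i = w] = \deg_{P_m}(w)/(2m)$. Let $Y$ be whichever of $X^1$, $X^2$ has the smaller degree in $P_m$, where a tie is resolved by an independent fair coin toss. Then $P_{m+1}$ is obtained from $P_m$ by adding a new vertex $v_{m+2}$ and an edge between $v_{m+2}$ and $Y$. Theorem. With high probability, the maximum degree $\Delta(P_m)$ of $P_m$ is $\frac{\log\log m}{\log 2} + \Theta(1)$; that is, there is an absolute constant $C$ such that $$\Pr\left[\,\left|\Delta(P_m) - \frac{\log\log m}{\log 2}\right| \le C\,\right] \longrightarrow 1 \qquad\text{as } m \to \infty .$$ -/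

import Mathlib

open Filter Topology
open scoped ENNReal

namespace MinChoice

/-- Trees with `m` edges on the labelled vertex set `{0, …, m}`; vertex `i` is the `(i+1)`-st
vertex in order of arrival. -/
def LabelledTree (m : ℕ) : Type := {G : SimpleGraph (Fin (m + 1)) // G.IsTree}

open Classical in
/-- The degree of the vertex `v` in the tree `T`. -/
noncomputable def LabelledTree.deg {m : ℕ} (T : LabelledTree m) (v : Fin (m + 1)) : ℕ :=
  T.1.degree v

open Classical in
/-- The maximum degree of the tree `T`. -/
noncomputable def LabelledTree.maxDeg {m : ℕ} (T : LabelledTree m) : ℕ :=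
  T.1.maxDegree

/-- The graph obtained from `G` by adding a new (last) vertex and one edge joining it to the old
vertex `y`. -/
def attachGraph {m : ℕ} (G : SimpleGraph (Fin (m + 1))) (y : Fin (m + 1)) :
    SimpleGraph (Fin (m + 1 + 1)) :=
  G.map Fin.castSuccEmb ⊔ SimpleGraph.edge y.castSucc (Fin.last (m + 1))

theorem attachGraph_isTree {m : ℕ} {G : SimpleGraph (Fin (m + 1))} (hG : G.IsTree)
    (y : Fin (m + 1)) : (attachGraph G y).IsTree := by
  classical
  have hn : ¬ (G.map Fin.castSuccEmb).Adj y.castSucc (Fin.last (m + 1)) := by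
    rintro ⟨-, ⟨a, b, -, -, hb⟩⟩
    exact (Fin.castSucc_lt_last b).ne hb
  rw [SimpleGraph.isTree_iff_connected_and_card]
  constructor
  · have hr : ∀ v : Fin (m + 1 + 1), (attachGraph G y).Reachable y.castSucc v := by
      intro v
      induction v using Fin.lastCases with
      | last =>
        refine SimpleGraph.Adj.reachable (Or.inr ?_)
        rw [SimpleGraph.edge_adj]
        exact ⟨Or.inl ⟨rfl, rfl⟩, (Fin.castSucc_lt_last y).ne⟩
      | cast w =>
        have h := (hG.connected.preconnected y w).map
          (SimpleGraph.Embedding.map Fin.castSuccEmb G).toHom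
        exact h.mono le_sup_left
    exact { preconnected := fun u v => (hr u).symm.trans (hr v), nonempty := ⟨0⟩ }
  · have h1 := hG.card_edgeFinset
    have h2 := SimpleGraph.card_edgeFinset_sup_edge (G.map Fin.castSuccEmb) hn
      (Fin.castSucc_lt_last y).ne
    have h3 := SimpleGraph.card_edgeFinset_map Fin.castSuccEmb G
    rw [attachGraph, Nat.card_eq_fintype_card, ← SimpleGraph.edgeFinset_card, h2]
    simp only [Fintype.card_fin, Nat.card_eq_fintype_card] at h1 ⊢
    have h4 : (G.map Fin.castSuccEmb).edgeFinset.card = G.edgeFinset.card := by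
      convert h3
    omega

/-- The tree obtained from `T` by joining a new (last) vertex to the old vertex `y`. -/
def LabelledTree.attach {m : ℕ} (T : LabelledTree m) (y : Fin (m + 1)) : LabelledTree (m + 1) :=
  ⟨attachGraph T.1 y, attachGraph_isTree T.2 y⟩

/-- The tree with one vertex and no edge. -/
def singleVertex : LabelledTree 0 :=
  ⟨⊥, haveI : Subsingleton (Fin (0 + 1)) := inferInstanceAs (Subsingleton (Fin 1))
    SimpleGraph.IsTree.of_subsingleton⟩

/-- The one-edge tree. -/
def singleEdge : LabelledTree 1 :=
  singleVertex.attach 0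

theorem LabelledTree.sum_deg {m : ℕ} (T : LabelledTree m) : ∑ v, T.deg v = 2 * m := by
  classical
  have h1 := T.1.sum_degrees_eq_twice_card_edges
  have h2 := T.2.card_edgeFinset
  rw [Fintype.card_fin] at h2
  have h3 : T.1.edgeFinset.card = m := by omega
  rw [h3] at h1
  rw [← h1]
  refine Finset.sum_congr rfl fun v _ => ?_
  unfold LabelledTree.deg
  congr!

/-- The law of a random vertex of `T` chosen with probability proportional to degree:
the vertex `w` has probability `deg w / (2 m)`, where `m` is the number of edges. -/
noncomputable def sizeBiased {m : ℕ} [NeZero m] (T : LabelledTree m) : PMF (Fin (m + 1)) :=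
  PMF.ofFintype (fun w => (T.deg w : ℝ≥0∞) / (2 * (m : ℝ≥0∞))) (by
    have h : ∑ v, (T.deg v : ℝ≥0∞) = 2 * (m : ℝ≥0∞) := by exact_mod_cast T.sum_deg
    simp only [div_eq_mul_inv]
    rw [← Finset.sum_mul, h]
    refine ENNReal.mul_inv_cancel ?_ ?_
    · simpa using NeZero.ne m
    · exact ENNReal.mul_ne_top (by simp) (by simp))

/-- Whichever of `x₁`, `x₂` has the smaller degree in `T`; a tie is resolved by a fair coin. -/
noncomputable def chooseMin {m : ℕ} (T : LabelledTree m) (x₁ x₂ : Fin (m + 1)) :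
    PMF (Fin (m + 1)) :=
  if T.deg x₁ < T.deg x₂ then PMF.pure x₁
  else if T.deg x₂ < T.deg x₁ then PMF.pure x₂
  else (PMF.uniformOfFintype Bool).map (fun b => if b then x₁ else x₂)

/-- One step of the process: draw two independent vertices with probability proportional to
degree and join a new vertex to the one of smaller degree. -/
noncomputable def step {m : ℕ} [NeZero m] (T : LabelledTree m) : PMF (LabelledTree (m + 1)) :=
  (sizeBiased T).bind fun x₁ =>
    (sizeBiased T).bind fun x₂ =>
      (chooseMin T x₁ x₂).map fun y => T.attach y

/-- The law of the min-choice preferential attachment tree `P_m` with `m` edges. The process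
starts from the one-edge tree `P_1`; the value at `m = 0` is only a convention. -/
noncomputable def law : (m : ℕ) → PMF (LabelledTree m)
  | 0 => PMF.pure singleVertex
  | 1 => PMF.pure singleEdge
  | m + 2 => (law (m + 1)).bind step

end MinChoice

/-!
Write `S_k(T)` for the sum of the degrees of the vertices of degree at least `k` in the tree `T`
(`LabelledTree.tailDeg`), and `p_k = S_k / (2 n)` for the resulting fraction when `T` has `n`
edges (`LabelledTree.tailFrac`). The chosen vertex has degree at least `k` iff both size-biased
vertices do, hence with probability `p_k ^ 2`. So for `k ≥ 2` the expected increment of `S_k` in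
one step is `k p_{k-1} ^ 2 - (k - 1) p_k ^ 2`, and its exponential moments are given exactly by
`stepExp_exp_tailDeg`. Thus `p_k` is of the order of `k p_{k-1} ^ 2`: the fractions decay doubly
exponentially in `k`, and the maximum degree is the level at which `2 ^ 2 ^ k` reaches a power
of `n`.

*Upper bound.* For `k ≤ 9` the negative part of the drift pushes `p_k` below explicit constants
down to `p_9 ≤ 3 / 1000` (`TailAtMost.succ`, `tailAtMost_nine`). From there on, the crude drift
bound `k p_{k-1} ^ 2` and an exponential Markov inequality propagate estimates `S_k ≤ 2 (α_k n +
M_k)` with doubly exponentially small `α_k` and with `M_k` only exponentially large in `k`,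
valid at all times (`exists_upper_condition`). At time `t`, the first level `k` with `α_k ≤ 1 /
t` has `p_k` of the order `t⁻¹` up to a power of `log t`, so a vertex passes the top level at
time `t` with probability at most `t ^ (-3/2)`; this is summable, and before a fixed time the
degrees are bounded (`exists_upper_bound`).

*Lower bound.* Each time the chosen vertex has degree at least `k - 1`, the tail degree `S_k`
grows by at least one, so `S_k` dominates a sum of independent indicators with success
probability `p_{k-1} ^ 2`. Starting from `p_1 = 1`, this yields `p_k ≥ 16 (1/16) ^ 2 ^ (k - 1)`
from a time on that is polynomial in the inverse of this bound (`exists_lower_condition`).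

In both parts the estimate at level `k` is made on histories on which the previous levels behave
at all earlier times. Such restricted expectations are defined by recursion over the steps of
the process (`killedExp`), and `killedProb_all_le` compares them with the actual law.
-/

namespace MinChoice

/-! ### Degrees and degree tails -/

section Combinatorics

variable {m : ℕ}

open Classical in
theorem LabelledTree.deg_eq_sum (T : LabelledTree m) (v : Fin (m + 1)) :
    T.deg v = ∑ w, if T.1.Adj v w then 1 else 0 := by
  rw [LabelledTree.deg, ← SimpleGraph.card_neighborFinset_eq_degree,
    SimpleGraph.neighborFinset_eq_filter, Finset.card_filter]

theorem attachGraph_adj_castSucc {G : SimpleGraph (Fin (m + 1))} {y a b : Fin (m + 1)} :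
    (attachGraph G y).Adj a.castSucc b.castSucc ↔ G.Adj a b := by
  have h : ∀ b : Fin (m + 1), b.castSucc ≠ Fin.last (m + 1) :=
    fun b => (Fin.castSucc_lt_last b).ne
  have h2 : (G.map Fin.castSuccEmb).Adj a.castSucc b.castSucc ↔ G.Adj a b :=
    SimpleGraph.map_adj_apply (f := Fin.castSuccEmb)
  rw [attachGraph, SimpleGraph.sup_adj, h2, SimpleGraph.edge_adj]
  simp [h]

theorem attachGraph_adj_last {G : SimpleGraph (Fin (m + 1))} {y a : Fin (m + 1)} :
    (attachGraph G y).Adj a.castSucc (Fin.last (m + 1)) ↔ a = y := by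
  have h : ∀ b : Fin (m + 1), b.castSucc ≠ Fin.last (m + 1) :=
    fun b => (Fin.castSucc_lt_last b).ne
  simp only [attachGraph, SimpleGraph.sup_adj, SimpleGraph.map_adj, SimpleGraph.edge_adj]
  constructor
  · rintro (⟨c, d, -, -, hd⟩ | ⟨h1 | h1, -⟩)
    · exact absurd hd (h d)
    · exact Fin.castSucc_injective _ h1.1
    · exact absurd h1.1 (h a)
  · rintro rfl
    exact Or.inr ⟨Or.inl (by simp), h a⟩

open Classical in
theorem LabelledTree.deg_attach_castSucc (T : LabelledTree m) (y v : Fin (m + 1)) :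
    (T.attach y).deg v.castSucc = T.deg v + if v = y then 1 else 0 := by
  rw [deg_eq_sum, deg_eq_sum, Fin.sum_univ_castSucc]
  simp only [LabelledTree.attach, attachGraph_adj_castSucc, attachGraph_adj_last]

theorem LabelledTree.deg_attach_last (T : LabelledTree m) (y : Fin (m + 1)) :
    (T.attach y).deg (Fin.last (m + 1)) = 1 := by
  classical
  rw [deg_eq_sum, Fin.sum_univ_castSucc]
  simp only [LabelledTree.attach, SimpleGraph.irrefl, SimpleGraph.adj_comm _ (Fin.last (m + 1)),
    attachGraph_adj_last]
  simp

/-- The sum of the degrees of the vertices of degree at least `k`. -/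
noncomputable def LabelledTree.tailDeg (T : LabelledTree m) (k : ℕ) : ℕ :=
  ∑ v, if k ≤ T.deg v then T.deg v else 0

/-- The probability that a size-biased random vertex has degree at least `k`. -/
noncomputable def LabelledTree.tailFrac (T : LabelledTree m) (k : ℕ) : ℝ :=
  T.tailDeg k / (2 * m)

theorem LabelledTree.tailDeg_one (T : LabelledTree m) : T.tailDeg 1 = 2 * m := by
  rw [← T.sum_deg, LabelledTree.tailDeg]
  refine Finset.sum_congr rfl fun v _ => ?_
  split_ifs <;> omega

theorem LabelledTree.tailDeg_anti (T : LabelledTree m) {j k : ℕ} (h : j ≤ k) :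
    T.tailDeg k ≤ T.tailDeg j := by
  refine Finset.sum_le_sum fun v _ => ?_
  split_ifs <;> omega

theorem LabelledTree.tailDeg_le (T : LabelledTree m) (k : ℕ) : T.tailDeg k ≤ 2 * m := by
  rw [← T.sum_deg]
  refine Finset.sum_le_sum fun v _ => ?_
  split_ifs <;> omega

theorem LabelledTree.tailDeg_pos_iff (T : LabelledTree m) {k : ℕ} (hk : 1 ≤ k) :
    0 < T.tailDeg k ↔ k ≤ T.maxDeg := by
  classical
  have hd : ∀ v, T.deg v = T.1.degree v := fun v => by
    unfold LabelledTree.deg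
    congr!
  have hm : T.maxDeg = T.1.maxDegree := by
    unfold LabelledTree.maxDeg
    congr!
  rw [hm, LabelledTree.tailDeg]
  constructor
  · intro h
    obtain ⟨v, -, hv⟩ := Finset.exists_ne_zero_of_sum_ne_zero h.ne'
    have h1 : k ≤ T.deg v := by
      by_contra hc
      simp [hc] at hv
    exact h1.trans ((hd v).le.trans (T.1.degree_le_maxDegree v))
  · intro h
    obtain ⟨v, hv⟩ := T.1.exists_maximal_degree_vertex
    rw [hv, ← hd v] at h
    refine Finset.sum_pos' (fun _ _ => Nat.zero_le _) ⟨v, Finset.mem_univ _, ?_⟩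
    rw [if_pos h]
    omega

theorem LabelledTree.maxDeg_le (T : LabelledTree m) : T.maxDeg ≤ m := by
  classical
  have hm : T.maxDeg = T.1.maxDegree := by
    unfold LabelledTree.maxDeg
    congr!
  rw [hm]
  refine T.1.maxDegree_le_of_forall_degree_le _ fun v => ?_
  have h := T.1.degree_lt_card_verts v
  rw [Fintype.card_fin] at h
  omega

/-- Attaching a vertex to `y` moves `y` into the tail if its degree was `k - 1`, and otherwise
adds one to the tail exactly if `y` already belonged to it. -/
theorem LabelledTree.tailDeg_attach (T : LabelledTree m) (y : Fin (m + 1)) {k : ℕ} (hk : 2 ≤ k) :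
    (T.attach y).tailDeg k =
      T.tailDeg k + if k ≤ T.deg y then 1 else if k - 1 ≤ T.deg y then k else 0 := by
  classical
  have h : ∀ v : Fin (m + 1),
      (if k ≤ (T.attach y).deg v.castSucc then (T.attach y).deg v.castSucc else 0) =
        (if k ≤ T.deg v then T.deg v else 0) +
          if v = y then (if k ≤ T.deg y then 1 else if k - 1 ≤ T.deg y then k else 0)
            else 0 := by
    intro v
    rw [LabelledTree.deg_attach_castSucc]
    by_cases hv : v = y
    · subst hv
      simp only [if_true]
      split_ifs <;> omega
    · simp [hv]
  rw [LabelledTree.tailDeg, Fin.sum_univ_castSucc, LabelledTree.deg_attach_last,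
    if_neg (by omega), add_zero, Finset.sum_congr rfl fun v _ => h v, Finset.sum_add_distrib,
    LabelledTree.tailDeg]
  simp

theorem LabelledTree.tailFrac_nonneg (T : LabelledTree m) (k : ℕ) : 0 ≤ T.tailFrac k := by
  unfold LabelledTree.tailFrac
  positivity

theorem LabelledTree.tailFrac_anti (T : LabelledTree m) {j k : ℕ} (h : j ≤ k) :
    T.tailFrac k ≤ T.tailFrac j := by
  unfold LabelledTree.tailFrac
  have := T.tailDeg_anti h
  gcongr

theorem LabelledTree.tailFrac_le_one (T : LabelledTree m) (k : ℕ) : T.tailFrac k ≤ 1 := by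
  unfold LabelledTree.tailFrac
  refine div_le_one_of_le₀ ?_ (by positivity)
  exact_mod_cast T.tailDeg_le k

end Combinatorics

/-! ### One step of the process -/

theorem toOuterMeasure_chooseMin {m : ℕ} (T : LabelledTree m) (x₁ x₂ : Fin (m + 1)) (k : ℕ) :
    (chooseMin T x₁ x₂).toOuterMeasure {y | k ≤ T.deg y} =
      (if k ≤ T.deg x₁ then 1 else 0) * (if k ≤ T.deg x₂ then 1 else 0) := by
  classical
  unfold chooseMin
  by_cases h1 : T.deg x₁ < T.deg x₂
  · rw [if_pos h1, PMF.toOuterMeasure_pure_apply]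
    simp only [Set.mem_ofPred_eq]
    split_ifs <;> first | omega | simp
  by_cases h2 : T.deg x₂ < T.deg x₁
  · rw [if_neg h1, if_pos h2, PMF.toOuterMeasure_pure_apply]
    simp only [Set.mem_ofPred_eq]
    split_ifs <;> first | omega | simp
  have h3 : T.deg x₁ = T.deg x₂ := by omega
  rw [if_neg h1, if_neg h2, PMF.toOuterMeasure_map_apply]
  by_cases h4 : k ≤ T.deg x₁
  · have : (fun b : Bool => if b then x₁ else x₂) ⁻¹' {y | k ≤ T.deg y} = Set.univ := by
      ext b; cases b <;> simp <;> omega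
    rw [this, (PMF.toOuterMeasure_apply_eq_one_iff _ _).2 (Set.subset_univ _), if_pos h4,
      if_pos (h3 ▸ h4), one_mul]
  · have : (fun b : Bool => if b then x₁ else x₂) ⁻¹' {y | k ≤ T.deg y} = ∅ := by
      ext b; cases b <;> simp <;> omega
    rw [this, if_neg h4]
    simp

section OneStep

variable {m : ℕ} [NeZero m]

/-- The law of the vertex to which the new vertex gets attached. -/
noncomputable def chosen (T : LabelledTree m) : PMF (Fin (m + 1)) :=
  (sizeBiased T).bind fun x₁ => (sizeBiased T).bind fun x₂ => chooseMin T x₁ x₂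

theorem step_eq_map_chosen (T : LabelledTree m) : step T = (chosen T).map T.attach := by
  simp only [step, chosen, PMF.map_bind]

theorem tsum_sizeBiased_tail (T : LabelledTree m) (k : ℕ) :
    ∑' x, sizeBiased T x * (if k ≤ T.deg x then 1 else 0) = ENNReal.ofReal (T.tailFrac k) := by
  have hm : (0 : ℝ) < m := by exact_mod_cast Nat.pos_of_ne_zero (NeZero.ne m)
  rw [tsum_fintype, LabelledTree.tailFrac, LabelledTree.tailDeg,
    ENNReal.ofReal_div_of_pos (by positivity), ENNReal.ofReal_natCast, Nat.cast_sum,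
    ENNReal.ofReal_mul (by norm_num), ENNReal.ofReal_natCast, div_eq_mul_inv, Finset.sum_mul]
  refine Finset.sum_congr rfl fun v _ => ?_
  simp only [sizeBiased, PMF.ofFintype_apply]
  split_ifs <;> simp [div_eq_mul_inv]

/-- The smaller of two independent size-biased degrees is at least `k` iff both are. -/
theorem toOuterMeasure_chosen (T : LabelledTree m) (k : ℕ) :
    (chosen T).toOuterMeasure {y | k ≤ T.deg y} = ENNReal.ofReal (T.tailFrac k ^ 2) := by
  rw [chosen, PMF.toOuterMeasure_bind_apply]
  simp_rw [PMF.toOuterMeasure_bind_apply, toOuterMeasure_chooseMin]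
  have h : ∀ x₁, ∑' x₂, sizeBiased T x₂ *
      ((if k ≤ T.deg x₁ then 1 else 0) * (if k ≤ T.deg x₂ then 1 else 0)) =
      (if k ≤ T.deg x₁ then 1 else 0) * ENNReal.ofReal (T.tailFrac k) := by
    intro x₁
    rw [← tsum_sizeBiased_tail, ← ENNReal.tsum_mul_left]
    exact tsum_congr fun x₂ => by ring
  simp_rw [h, ← mul_assoc]
  rw [ENNReal.tsum_mul_right, tsum_sizeBiased_tail, sq,
    ENNReal.ofReal_mul (T.tailFrac_nonneg k)]

/-- The conditional expectation of `f` after one step started from `T`. -/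
noncomputable def stepExp (T : LabelledTree m) (f : LabelledTree (m + 1) → ℝ) : ℝ :=
  ∑ y, (chosen T y).toReal * f (T.attach y)

theorem stepExp_mono (T : LabelledTree m) {f g : LabelledTree (m + 1) → ℝ}
    (h : ∀ y, f (T.attach y) ≤ g (T.attach y)) : stepExp T f ≤ stepExp T g :=
  Finset.sum_le_sum fun y _ => mul_le_mul_of_nonneg_left (h y) ENNReal.toReal_nonneg

theorem stepExp_add (T : LabelledTree m) (f g : LabelledTree (m + 1) → ℝ) :
    stepExp T (fun T' => f T' + g T') = stepExp T f + stepExp T g := by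
  simp only [stepExp, mul_add, Finset.sum_add_distrib]

theorem stepExp_const_mul (T : LabelledTree m) (c : ℝ) (f : LabelledTree (m + 1) → ℝ) :
    stepExp T (fun T' => c * f T') = c * stepExp T f := by
  simp only [stepExp, Finset.mul_sum]
  exact Finset.sum_congr rfl fun y _ => by ring

theorem sum_chosen (T : LabelledTree m) : ∑ y, (chosen T y).toReal = 1 := by
  rw [← ENNReal.toReal_sum fun y _ => PMF.apply_ne_top _ _,
    ← tsum_fintype (L := SummationFilter.unconditional _), PMF.tsum_coe, ENNReal.toReal_one]

theorem stepExp_const (T : LabelledTree m) (c : ℝ) : stepExp T (fun _ => c) = c := by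
  rw [stepExp, ← Finset.sum_mul, sum_chosen, one_mul]

theorem stepExp_le_of_le (T : LabelledTree m) {f : LabelledTree (m + 1) → ℝ} {c : ℝ}
    (h : ∀ y, f (T.attach y) ≤ c) : stepExp T f ≤ c :=
  (stepExp_mono T h).trans_eq (stepExp_const T c)

theorem stepExp_nonneg (T : LabelledTree m) {f : LabelledTree (m + 1) → ℝ}
    (h : ∀ y, 0 ≤ f (T.attach y)) : 0 ≤ stepExp T f :=
  Finset.sum_nonneg fun y _ => mul_nonneg ENNReal.toReal_nonneg (h y)

theorem sum_chosen_tail (T : LabelledTree m) (k : ℕ) :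
    ∑ y, (chosen T y).toReal * (if k ≤ T.deg y then 1 else 0) = T.tailFrac k ^ 2 := by
  have h := toOuterMeasure_chosen T k
  rw [PMF.toOuterMeasure_apply_fintype] at h
  rw [← ENNReal.toReal_ofReal (sq_nonneg (T.tailFrac k)), ← h,
    ENNReal.toReal_sum fun y _ => ?_]
  · refine Finset.sum_congr rfl fun y _ => ?_
    by_cases hy : k ≤ T.deg y <;> simp [hy]
  · refine ne_top_of_le_ne_top (PMF.apply_ne_top (chosen T) y) ?_
    exact Set.indicator_le_self _ _ _

/-- The exact one-step evolution of the exponential moments of the degree tail. -/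
theorem stepExp_exp_tailDeg (T : LabelledTree m) {k : ℕ} (hk : 2 ≤ k) (l : ℝ) :
    stepExp T (fun T' => Real.exp (l * T'.tailDeg k)) =
      Real.exp (l * T.tailDeg k) * (1 + (Real.exp (l * k) - 1) * T.tailFrac (k - 1) ^ 2
        - (Real.exp (l * k) - Real.exp l) * T.tailFrac k ^ 2) := by
  rw [← sum_chosen_tail, ← sum_chosen_tail]
  nth_rw 1 [← sum_chosen T]
  rw [stepExp, Finset.mul_sum, Finset.mul_sum, ← Finset.sum_add_distrib, ← Finset.sum_sub_distrib,
    Finset.mul_sum]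
  refine Finset.sum_congr rfl fun y _ => ?_
  rw [LabelledTree.tailDeg_attach T y hk, Nat.cast_add, mul_add, Real.exp_add]
  by_cases h1 : k ≤ T.deg y
  · have h2 : k - 1 ≤ T.deg y := by omega
    simp only [h1, h2, if_true, Nat.cast_one, mul_one]
    ring
  · by_cases h2 : k - 1 ≤ T.deg y
    · simp only [h1, h2, if_true, if_false]
      ring
    · simp only [h1, h2, if_false]
      simp
      ring

/-- The probability that a vertex of degree at least `k` appears in one step. -/
theorem stepExp_tailDeg_pos_le (T : LabelledTree m) {k : ℕ} (hk : 2 ≤ k) :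
    stepExp T ({T' | 0 < T'.tailDeg k}.indicator 1) ≤
      {T | 0 < T.tailDeg k}.indicator 1 T + T.tailFrac (k - 1) ^ 2 := by
  classical
  have hi : {T : LabelledTree m | 0 < T.tailDeg k}.indicator (1 : LabelledTree m → ℝ) T =
      if 0 < T.tailDeg k then 1 else 0 := by
    simp only [Set.indicator_apply, Set.mem_ofPred_eq, Pi.one_apply]
  rw [← sum_chosen_tail, hi]
  nth_rw 1 [← stepExp_const T (if 0 < T.tailDeg k then 1 else 0)]
  rw [stepExp, stepExp, ← Finset.sum_add_distrib]
  refine Finset.sum_le_sum fun y _ => ?_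
  rw [← mul_add]
  refine mul_le_mul_of_nonneg_left ?_ ENNReal.toReal_nonneg
  simp only [Set.indicator_apply, Set.mem_ofPred_eq, Pi.one_apply,
    LabelledTree.tailDeg_attach T y hk]
  split_ifs <;> first | (exfalso; omega) | norm_num

end OneStep

/-! ### Expectations restricted to good histories -/

/-- A condition on the tree at each time; the entry `n` speaks of the tree with `n + 1` edges. -/
abbrev Condition : Type := ∀ n : ℕ, Set (LabelledTree (n + 1))

/-- The expectation of `f (P_{n+1})` restricted to the event that `P_{i+1} ∈ G i` for all
`i < n`. The event is about the whole history of the process; it is encoded by killing the process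
at the first violation of the condition, so that no space of trajectories is needed. -/
noncomputable def killedExp (G : Condition) : ∀ n : ℕ, (LabelledTree (n + 1) → ℝ) → ℝ
  | 0, f => f singleEdge
  | n + 1, f => killedExp G n ((G n).indicator fun T => stepExp T f)

/-- The probability that the history is good strictly before time `n + 1` and that the tree with
`n + 1` edges lies in `A`. -/
noncomputable def killedProb (G : Condition) (n : ℕ) (A : Set (LabelledTree (n + 1))) : ℝ :=
  killedExp G n (A.indicator 1)

variable {G H : Condition}

theorem killedExp_succ (G : Condition) (n : ℕ) (f : LabelledTree (n + 1 + 1) → ℝ) :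
    killedExp G (n + 1) f = killedExp G n ((G n).indicator fun T => stepExp T f) := rfl

theorem killedExp_mono (n : ℕ) {f g : LabelledTree (n + 1) → ℝ} (h : ∀ T, f T ≤ g T) :
    killedExp G n f ≤ killedExp G n g := by
  induction n with
  | zero => exact h _
  | succ n ih =>
    exact ih fun T => Set.indicator_le_indicator (stepExp_mono T fun y => h _)

theorem killedExp_add (n : ℕ) (f g : LabelledTree (n + 1) → ℝ) :
    killedExp G n (fun T => f T + g T) = killedExp G n f + killedExp G n g := by
  induction n with
  | zero => rfl
  | succ n ih =>
    rw [killedExp_succ, killedExp_succ, killedExp_succ, ← ih]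
    congr 1
    funext T
    by_cases hT : T ∈ G n <;> simp [hT, stepExp_add]

theorem killedExp_const_mul (n : ℕ) (c : ℝ) (f : LabelledTree (n + 1) → ℝ) :
    killedExp G n (fun T => c * f T) = c * killedExp G n f := by
  induction n with
  | zero => rfl
  | succ n ih =>
    rw [killedExp_succ, killedExp_succ, ← ih]
    congr 1
    funext T
    by_cases hT : T ∈ G n <;> simp [hT, stepExp_const_mul]

theorem killedExp_nonneg (n : ℕ) {f : LabelledTree (n + 1) → ℝ} (h : ∀ T, 0 ≤ f T) :
    0 ≤ killedExp G n f := by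
  have h0 := killedExp_const_mul (G := G) n 0 f
  rw [zero_mul] at h0
  rw [← h0]
  exact killedExp_mono n fun T => by simpa using h T

theorem killedExp_const_le (n : ℕ) {c : ℝ} (hc : 0 ≤ c) : killedExp G n (fun _ => c) ≤ c := by
  induction n with
  | zero => exact le_rfl
  | succ n ih =>
    refine le_trans (killedExp_mono n fun T => ?_) ih
    simp only [stepExp_const]
    exact Set.indicator_le_self' (fun _ _ => hc) T

theorem killedExp_le_of_le (n : ℕ) {f : LabelledTree (n + 1) → ℝ} {c : ℝ} (hc : 0 ≤ c)
    (h : ∀ T, f T ≤ c) : killedExp G n f ≤ c :=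
  (killedExp_mono n h).trans (killedExp_const_le n hc)

theorem killedExp_anti (hGH : ∀ n, G n ⊆ H n) (n : ℕ) {f : LabelledTree (n + 1) → ℝ}
    (h : ∀ T, 0 ≤ f T) : killedExp G n f ≤ killedExp H n f := by
  induction n with
  | zero => exact le_rfl
  | succ n ih =>
    rw [killedExp_succ, killedExp_succ]
    have h0 : ∀ T : LabelledTree (n + 1), 0 ≤ stepExp T f := fun T => stepExp_nonneg T fun _ => h _
    exact (killedExp_mono n fun T => Set.indicator_le_indicator_of_subset (hGH n) h0 T).trans
      (ih fun T => Set.indicator_nonneg (fun T _ => h0 T) T)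

theorem killedExp_succ_le_of_le (n : ℕ) {f : LabelledTree (n + 1 + 1) → ℝ} {c : ℝ} (hc : 0 ≤ c)
    (h : ∀ T ∈ G n, stepExp T f ≤ c) : killedExp G (n + 1) f ≤ c := by
  refine killedExp_le_of_le n hc fun T => ?_
  exact Set.indicator_apply_le' (fun hT => h T hT) fun _ => hc

theorem killedExp_succ_le_of_step_le (n : ℕ) {f : LabelledTree (n + 1 + 1) → ℝ}
    {g : LabelledTree (n + 1) → ℝ} (hg : ∀ T, 0 ≤ g T)
    (h : ∀ T ∈ G n, stepExp T f ≤ g T) : killedExp G (n + 1) f ≤ killedExp G n g :=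
  killedExp_mono n fun T => Set.indicator_apply_le' (fun hT => h T hT) fun _ => hg T

theorem indicator_one_nonneg {α : Type*} (A : Set α) (x : α) :
    (0 : ℝ) ≤ A.indicator 1 x :=
  Set.indicator_nonneg (fun _ _ => zero_le_one) x

theorem killedProb_mono (n : ℕ) {A B : Set (LabelledTree (n + 1))} (h : A ⊆ B) :
    killedProb G n A ≤ killedProb G n B :=
  killedExp_mono n fun T =>
    Set.indicator_le_indicator_of_subset h (fun _ => zero_le_one) T

theorem killedProb_union_le (n : ℕ) (A B : Set (LabelledTree (n + 1))) :
    killedProb G n (A ∪ B) ≤ killedProb G n A + killedProb G n B := by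
  rw [killedProb, killedProb, killedProb, ← killedExp_add]
  refine killedExp_mono n fun T => ?_
  by_cases hA : T ∈ A <;> by_cases hB : T ∈ B <;> simp [hA, hB]

/-- Markov's inequality. -/
theorem killedProb_le_of_one_le (n : ℕ) {A : Set (LabelledTree (n + 1))}
    {f : LabelledTree (n + 1) → ℝ} {c : ℝ} (hc : 0 ≤ c) (hf : ∀ T, 0 ≤ f T)
    (h : ∀ T ∈ A, 1 ≤ c * f T) : killedProb G n A ≤ c * killedExp G n f := by
  rw [← killedExp_const_mul]
  exact killedExp_mono n fun T =>
    Set.indicator_apply_le' (fun hT => h T hT) fun _ => mul_nonneg hc (hf T)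

/-- The unrestricted condition. -/
def Condition.all : Condition := fun _ => Set.univ

theorem killedExp_all_succ (n : ℕ) (f : LabelledTree (n + 1 + 1) → ℝ) :
    killedExp Condition.all (n + 1) f = killedExp Condition.all n fun T => stepExp T f := by
  rw [killedExp_succ]
  congr 1
  exact Set.indicator_univ _

/-- The conjunction of two conditions. -/
def Condition.and (G H : Condition) : Condition := fun n => G n ∩ H n

theorem Condition.and_subset_left (G H : Condition) (n : ℕ) : (G.and H) n ⊆ G n :=
  Set.inter_subset_left

theorem Condition.and_subset_right (G H : Condition) (n : ℕ) : (G.and H) n ⊆ H n :=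
  Set.inter_subset_right

/-- The condition `G` fails with probability at most `ε`. -/
def FailsLE (G : Condition) (ε : ℝ) : Prop :=
  ∀ n, ∑ i ∈ Finset.range n, killedProb G i (G i)ᶜ ≤ ε

theorem failsLE_all : FailsLE Condition.all 0 := fun n => by
  refine (Finset.sum_eq_zero fun i _ => ?_).le
  rw [killedProb, Condition.all, Set.compl_univ, Set.indicator_empty]
  have h := killedExp_const_mul (G := Condition.all) i 0 (fun _ => 0)
  simpa using h

/-- To impose a further condition, it suffices to control it on histories on which the old
conditions hold. -/
theorem FailsLE.and {ε δ : ℝ} (hG : FailsLE G ε)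
    (hH : ∀ n, ∑ i ∈ Finset.range n, killedProb G i (H i)ᶜ ≤ δ) :
    FailsLE (G.and H) (ε + δ) := fun n => by
  refine le_trans ?_ (add_le_add (hG n) (hH n))
  rw [← Finset.sum_add_distrib]
  refine Finset.sum_le_sum fun i _ => ?_
  have h1 : killedProb (G.and H) i ((G.and H) i)ᶜ ≤ killedProb G i ((G.and H) i)ᶜ :=
    killedExp_anti (fun n => Set.inter_subset_left) i (indicator_one_nonneg _)
  refine h1.trans ?_
  rw [Condition.and, Set.compl_inter]
  exact killedProb_union_le i _ _

/-- An event is at most as likely as a violation of the condition beforehand, plus its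
probability on good histories. -/
theorem killedProb_all_le (n : ℕ) (A : Set (LabelledTree (n + 1))) :
    killedProb Condition.all n A ≤
      killedProb G n A + ∑ i ∈ Finset.range n, killedProb G i (G i)ᶜ := by
  suffices h : ∀ f : LabelledTree (n + 1) → ℝ, (∀ T, 0 ≤ f T) → (∀ T, f T ≤ 1) →
      killedExp Condition.all n f ≤
        killedExp G n f + ∑ i ∈ Finset.range n, killedProb G i (G i)ᶜ from
    h _ (indicator_one_nonneg A) fun T => Set.indicator_le_self' (fun _ _ => zero_le_one) T
  clear A
  induction n with
  | zero => intro f _ _; simp [killedExp]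
  | succ n ih =>
    intro f hf0 hf1
    rw [killedExp_all_succ, Finset.sum_range_succ]
    have h2 := ih (fun T => stepExp T f) (fun T => stepExp_nonneg T fun _ => hf0 _)
      fun T => stepExp_le_of_le T fun _ => hf1 _
    have h3 : (killedExp G n fun T => stepExp T f) ≤
        killedExp G (n + 1) f + killedProb G n (G n)ᶜ := by
      rw [killedExp_succ, killedProb, ← killedExp_add]
      refine killedExp_mono n fun T => ?_
      by_cases hT : T ∈ G n
      · simp [hT]
      · simpa [hT] using stepExp_le_of_le T fun _ => hf1 _
    linarith

/-- The law of the process in terms of the expectation without any condition. -/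
theorem toOuterMeasure_law (n : ℕ) (A : Set (LabelledTree (n + 1))) :
    (law (n + 1)).toOuterMeasure A = ENNReal.ofReal (killedProb Condition.all n A) := by
  have key : ∀ n, ∀ f : LabelledTree (n + 1) → ℝ, (∀ T, 0 ≤ f T) →
      ∑' T, law (n + 1) T * ENNReal.ofReal (f T) =
        ENNReal.ofReal (killedExp Condition.all n f) := by
    intro n
    induction n with
    | zero =>
      intro f _
      rw [tsum_eq_single singleEdge]
      · simp [law, killedExp]
      · intro T hT
        simp [law, hT]
    | succ n ih =>
      intro f hf
      have hstep : ∀ T : LabelledTree (n + 1),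
          ∑' T', step T T' * ENNReal.ofReal (f T') = ENNReal.ofReal (stepExp T f) := by
        intro T
        rw [stepExp, ENNReal.ofReal_sum_of_nonneg
          fun y _ => mul_nonneg ENNReal.toReal_nonneg (hf _), step_eq_map_chosen]
        classical
        simp_rw [PMF.map_apply, ← ENNReal.tsum_mul_right]
        rw [ENNReal.tsum_comm, tsum_fintype]
        refine Finset.sum_congr rfl fun y _ => ?_
        rw [tsum_eq_single (T.attach y)]
        · rw [if_pos rfl, ENNReal.ofReal_mul ENNReal.toReal_nonneg,
            ENNReal.ofReal_toReal (PMF.apply_ne_top _ _)]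
        · intro T' hT'
          rw [if_neg hT', zero_mul]
      rw [killedExp_all_succ, ← ih _ fun T => stepExp_nonneg T fun _ => hf _]
      simp_rw [← hstep, ← ENNReal.tsum_mul_left]
      rw [ENNReal.tsum_comm]
      refine tsum_congr fun T' => ?_
      rw [show law (n + 1 + 1) = (law (n + 1)).bind step from rfl, PMF.bind_apply,
        ← ENNReal.tsum_mul_right]
      exact tsum_congr fun T => by ring
  rw [killedProb, ← key n _ (indicator_one_nonneg A), PMF.toOuterMeasure_apply]
  refine tsum_congr fun T => ?_
  by_cases hT : T ∈ A <;> simp [hT]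

/-! ### The first levels of degrees -/

/-- The condition that the tail of the degrees at `k` has at most the fraction `a` of the total
degree, up to an additive error `2 M`. -/
def tailBound (k : ℕ) (a M : ℝ) : Condition := fun n =>
  {T | (T.tailDeg k : ℝ) ≤ 2 * (a * (n + 1) + M)}

/-- With probability arbitrarily close to one, the fraction of the total degree carried by the
vertices of degree at least `k` stays below `a`, up to an additive error in the tail degree that is
bounded in time. -/
def TailAtMost (k : ℕ) (a : ℝ) : Prop :=
  ∀ ε > 0, ∃ M ≥ 0, ∃ G : Condition, FailsLE G ε ∧ ∀ n, G n ⊆ tailBound k a M n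

theorem tailAtMost_one : TailAtMost 1 1 := fun ε hε =>
  ⟨0, le_rfl, Condition.all, fun n => (failsLE_all n).trans hε.le, fun n T _ => by
    simp only [tailBound, Set.mem_ofPred_eq, T.tailDeg_one]
    push_cast
    linarith⟩

theorem tailFrac_le_of_tailDeg_le {n : ℕ} {T : LabelledTree (n + 1)} {k : ℕ} {x : ℝ}
    (h : (T.tailDeg k : ℝ) ≤ 2 * (x * (n + 1))) : T.tailFrac k ≤ x := by
  rw [LabelledTree.tailFrac, div_le_iff₀ (by positivity)]
  push_cast
  linarith

theorem le_tailFrac_of_le_tailDeg {n : ℕ} {T : LabelledTree (n + 1)} {k : ℕ} {x : ℝ}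
    (h : 2 * (x * (n + 1)) ≤ (T.tailDeg k : ℝ)) : x ≤ T.tailFrac k := by
  rw [LabelledTree.tailFrac, le_div_iff₀ (by positivity)]
  push_cast
  linarith

theorem tailDeg_attach_le {m : ℕ} (T : LabelledTree m) (y : Fin (m + 1)) {k : ℕ} (hk : 2 ≤ k) :
    ((T.attach y).tailDeg k : ℝ) ≤ T.tailDeg k + k := by
  rw [T.tailDeg_attach y hk]
  norm_cast
  split_ifs <;> omega

theorem exp_sub_one_le {x : ℝ} (h0 : 0 ≤ x) (h1 : x ≤ 1) : Real.exp x - 1 ≤ x + x ^ 2 := by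
  have h := Real.abs_exp_sub_one_sub_id_le (x := x) (by rwa [abs_of_nonneg h0])
  linarith [(abs_le.1 h).2]

/-- The growth factor of the exponential moment of the tail degree, when the tail fraction `q` at
`k` is so large compared to the fraction `p` at `k - 1` that the drift is below `2 c`. -/
theorem growth_factor_le {k : ℕ} (hk : 1 ≤ k) {l p q c g : ℝ} (hl : 0 < l) (hlk : l * k ≤ 1)
    (hp1 : p ≤ 1) (hq : 0 ≤ q) (hqp : q ≤ p)
    (hd : k * p ^ 2 - (k - 1) * q ^ 2 ≤ 2 * c - g) (hg : l * k ^ 2 ≤ g) :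
    1 + (Real.exp (l * k) - 1) * p ^ 2 - (Real.exp (l * k) - Real.exp l) * q ^ 2 ≤
      Real.exp (2 * l * c) := by
  have hk' : (1 : ℝ) ≤ k := by exact_mod_cast hk
  have h1 := exp_sub_one_le (x := l * k) (by positivity) hlk
  have h2 := exp_sub_one_le (x := l) hl.le (by nlinarith)
  have hpq : q ^ 2 ≤ p ^ 2 := by gcongr
  have h3 := mul_le_mul_of_nonneg_right h1 (sub_nonneg.2 hpq)
  have h4 := mul_le_mul_of_nonneg_right h2 (sq_nonneg q)
  have h5 := Real.add_one_le_exp (2 * l * c)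
  have h6 := mul_le_mul_of_nonneg_left hd hl.le
  have h7 := mul_le_mul_of_nonneg_left hg hl.le
  have hp2 : p ^ 2 ≤ 1 := by nlinarith
  have h8 : l ^ 2 * k ^ 2 * p ^ 2 ≤ l ^ 2 * k ^ 2 := mul_le_of_le_one_right (by positivity) hp2
  have h9 : l ^ 2 * q ^ 2 ≤ l ^ 2 * k ^ 2 * q ^ 2 := by
    have : (1 : ℝ) ≤ (k : ℝ) ^ 2 := one_le_pow₀ hk'
    nlinarith [mul_nonneg (sq_nonneg l) (sq_nonneg q)]
  nlinarith

theorem exists_slack {k a b : ℝ} (hb : 0 < b) (h : k * a ^ 2 < 2 * b + (k - 1) * b ^ 2) :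
    ∃ η > 0, η < b ∧
      k * (a + η) ^ 2 - (k - 1) * (b - η) ^ 2 < 2 * (b - η) := by
  have hc : Continuous fun η : ℝ =>
      2 * (b - η) - (k * (a + η) ^ 2 - (k - 1) * (b - η) ^ 2) := by fun_prop
  have h1 : ∀ᶠ η in 𝓝 (0 : ℝ),
      0 < 2 * (b - η) - (k * (a + η) ^ 2 - (k - 1) * (b - η) ^ 2) :=
    (hc.tendsto 0).eventually (lt_mem_nhds (by simp; linarith))
  have h2 : ∀ᶠ η in 𝓝 (0 : ℝ), η < b := gt_mem_nhds hb
  obtain ⟨η, ⟨h3, h4⟩, h5⟩ :=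
    (((h1.and h2).filter_mono nhdsWithin_le_nhds).and
      (self_mem_nhdsWithin (s := Set.Ioi (0 : ℝ)))).exists
  exact ⟨η, h5, h4, by linarith⟩

theorem exists_mul_exp_le {A l ε : ℝ} (hl : 0 < l) (hε : 0 < ε) :
    ∃ M ≥ 0, A * Real.exp (-(l * M)) ≤ ε := by
  have h : Tendsto (fun M : ℝ => A * Real.exp (-(l * M))) atTop (𝓝 (A * 0)) :=
    (Real.tendsto_exp_neg_atTop_nhds_zero.comp (tendsto_id.const_mul_atTop hl)).const_mul A
  rw [mul_zero] at h
  obtain ⟨M, h1, h2⟩ := ((h.eventually (gt_mem_nhds hε)).and (eventually_ge_atTop 0)).exists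
  exact ⟨M, h2, h1.le⟩

/-- The exponential potential measuring the excess of the tail degree at `k` over `2 c n`. -/
noncomputable def tailPotential (k : ℕ) (l c : ℝ) (n : ℕ) (T : LabelledTree (n + 1)) : ℝ :=
  Real.exp (l * T.tailDeg k) * Real.exp (-(2 * l * c * (n + 1)))

theorem tailPotential_nonneg (k : ℕ) (l c : ℝ) (n : ℕ) (T : LabelledTree (n + 1)) :
    0 ≤ tailPotential k l c n T :=
  mul_nonneg (Real.exp_pos _).le (Real.exp_pos _).le

/-- Either the time is small compared to `M`, or the tail degree is below the target, or the
potential decreases on average. -/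
theorem stepExp_tailPotential_le {k : ℕ} (hk : 2 ≤ k) {n : ℕ} (T : LabelledTree (n + 1))
    {a c l g η M : ℝ} (hc0 : 0 < c) (hl : 0 < l) (hη : 0 < η) (hlk : l * k ≤ 1)
    (hlg : l * k ^ 2 ≤ g) (hg : g = 2 * c - (k * (a + η) ^ 2 - (k - 1) * c ^ 2))
    (hT1 : (T.tailDeg (k - 1) : ℝ) ≤ 2 * (a * (n + 1) + M)) :
    stepExp T (tailPotential k l c (n + 1)) ≤ tailPotential k l c n T +
      (Real.exp (l * k) + Real.exp (2 * l * (M / η + 1))) := by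
  have hk1 : (2 : ℝ) ≤ k := by exact_mod_cast hk
  have hk0 : (0 : ℝ) < k := by linarith
  by_cases h1 : η * (n + 1) < M
  · refine (stepExp_le_of_le T (c := Real.exp (2 * l * (M / η + 1))) fun y => ?_).trans ?_
    · have h2 : ((T.attach y).tailDeg k : ℝ) ≤ 2 * (n + 1 + 1) := by
        exact_mod_cast (T.attach y).tailDeg_le k
      have h3 : (n : ℝ) + 1 ≤ M / η := by
        rw [le_div_iff₀ hη]
        linarith
      simp only [tailPotential]
      rw [← Real.exp_add, Real.exp_le_exp]
      have h4 : (0 : ℝ) ≤ 2 * l * c * ((n + 1 : ℕ) + 1) := by positivity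
      have h5 := mul_le_mul_of_nonneg_left h2 hl.le
      have h6 := mul_le_mul_of_nonneg_left h3 hl.le
      nlinarith
    · linarith [tailPotential_nonneg k l c n T, Real.exp_pos (l * k)]
  by_cases h2 : (T.tailDeg k : ℝ) ≤ 2 * (c * (n + 1))
  · refine (stepExp_le_of_le T (c := Real.exp (l * k)) fun y => ?_).trans ?_
    · have h3 := tailDeg_attach_le T y hk
      simp only [tailPotential]
      rw [← Real.exp_add, Real.exp_le_exp]
      have h5 := mul_le_mul_of_nonneg_left (h3.trans (add_le_add_left h2 _)) hl.le
      push_cast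
      have h6 : 0 < l * c := by positivity
      nlinarith
    · linarith [tailPotential_nonneg k l c n T, Real.exp_pos (2 * l * (M / η + 1))]
  have h3 : T.tailFrac (k - 1) ≤ a + η := tailFrac_le_of_tailDeg_le (by nlinarith)
  have h4 : c ≤ T.tailFrac k := le_tailFrac_of_le_tailDeg (not_le.1 h2).le
  have h5 : k * T.tailFrac (k - 1) ^ 2 - (k - 1) * T.tailFrac k ^ 2 ≤ 2 * c - g := by
    have h6 : T.tailFrac (k - 1) ^ 2 ≤ (a + η) ^ 2 :=
      pow_le_pow_left₀ (T.tailFrac_nonneg _) h3 2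
    have h7 : c ^ 2 ≤ T.tailFrac k ^ 2 := pow_le_pow_left₀ hc0.le h4 2
    have h8 := mul_le_mul_of_nonneg_left h6 hk0.le
    have h9 := mul_le_mul_of_nonneg_left h7 (by linarith : (0 : ℝ) ≤ k - 1)
    linarith
  have h6 := growth_factor_le (by omega) hl hlk (T.tailFrac_le_one _) (T.tailFrac_nonneg k)
    (T.tailFrac_anti (by omega)) h5 hlg
  have h7 : stepExp T (tailPotential k l c (n + 1)) ≤ tailPotential k l c n T := by
    have h8 : stepExp T (tailPotential k l c (n + 1)) =
        Real.exp (-(2 * l * c * ((n + 1 : ℕ) + 1))) *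
          stepExp T fun T' => Real.exp (l * T'.tailDeg k) := by
      rw [← stepExp_const_mul]
      congr 1
      funext T'
      exact mul_comm _ _
    rw [h8, stepExp_exp_tailDeg T hk]
    refine (mul_le_mul_of_nonneg_left (mul_le_mul_of_nonneg_left h6 (Real.exp_pos _).le)
      (Real.exp_pos _).le).trans_eq ?_
    simp only [tailPotential]
    rw [← Real.exp_add, ← Real.exp_add, ← Real.exp_add]
    congr 1
    push_cast
    ring
  linarith [Real.exp_pos (l * k), Real.exp_pos (2 * l * (M / η + 1))]

/-- If the fraction of the tail at `k - 1` is at most `a`, then the tail degree at `k` drifts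
downwards relative to `2 b n` as long as it exceeds this value, provided that
`k a² < 2 b + (k - 1) b²`. -/
theorem TailAtMost.succ {k : ℕ} (hk : 2 ≤ k) {a b : ℝ} (ha : TailAtMost (k - 1) a)
    (hb : 0 < b) (h : k * a ^ 2 < 2 * b + (k - 1) * b ^ 2) : TailAtMost k b := by
  intro ε hε
  obtain ⟨M, hM, G, hG, hGM⟩ := ha (ε / 2) (by positivity)
  obtain ⟨η, hη, hηb, hgap⟩ := exists_slack hb h
  have hk1 : (2 : ℝ) ≤ k := by exact_mod_cast hk
  have hk0 : (0 : ℝ) < k := by linarith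
  obtain ⟨c, hc⟩ : ∃ c, c = b - η := ⟨_, rfl⟩
  obtain ⟨g, hg⟩ : ∃ g, g = 2 * c - (k * (a + η) ^ 2 - (k - 1) * c ^ 2) := ⟨_, rfl⟩
  have hc0 : 0 < c := by linarith
  have hg0 : 0 < g := by rw [hg, hc]; linarith
  obtain ⟨l, hl, hlk, hlg⟩ : ∃ l : ℝ, 0 < l ∧ l * k ≤ 1 ∧ l * k ^ 2 ≤ g := by
    refine ⟨min (1 / k) (g / k ^ 2), by positivity, ?_, ?_⟩
    · rw [← le_div_iff₀ hk0]
      exact min_le_left _ _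
    · rw [← le_div_iff₀ (by positivity)]
      exact min_le_right _ _
  obtain ⟨B, hB⟩ : ∃ B, B = Real.exp (l * k) + Real.exp (2 * l * (M / η + 1)) := ⟨_, rfl⟩
  have hB0 : 0 < B := by rw [hB]; positivity
  have hstep : ∀ n, ∀ T ∈ G n,
      stepExp T (tailPotential k l c (n + 1)) ≤ tailPotential k l c n T + B := by
    intro n T hT
    rw [hB]
    exact stepExp_tailPotential_le hk T hc0 hl hη hlk hlg hg (hGM n hT)
  -- The potential grows at most linearly, while the event `S_k > 2 (b n + M')` forces it to be
  -- exponentially large in `η n + M'`, as `c = b - η`.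
  have hE : ∀ n : ℕ, killedExp G n (tailPotential k l c n) ≤ B * (n + 1) := by
    intro n
    induction n with
    | zero =>
      have h1 : ((singleEdge).tailDeg k : ℝ) ≤ 2 := by exact_mod_cast singleEdge.tailDeg_le k
      have h2 : Real.exp (l * (singleEdge).tailDeg k) ≤ Real.exp (2 * l * (M / η + 1)) := by
        rw [Real.exp_le_exp]
        have : 0 ≤ M / η := by positivity
        have h3 := mul_le_mul_of_nonneg_left h1 hl.le
        nlinarith
      have h3 : Real.exp (-(2 * l * c * ((0 : ℕ) + 1))) ≤ 1 := by
        rw [Real.exp_le_one_iff]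
        have : 0 < l * c := by positivity
        push_cast
        linarith
      calc killedExp G 0 (tailPotential k l c 0) = tailPotential k l c 0 singleEdge := rfl
        _ ≤ Real.exp (l * (singleEdge).tailDeg k) := mul_le_of_le_one_right (Real.exp_pos _).le h3
        _ ≤ B * ((0 : ℕ) + 1) := by
          rw [hB]
          push_cast
          linarith [Real.exp_pos (l * k)]
    | succ n ih =>
      have h1 := killedExp_succ_le_of_step_le n
        (fun T => add_nonneg (tailPotential_nonneg k l c n T) hB0.le) (hstep n)
      rw [killedExp_add] at h1
      have h2 := killedExp_const_le (G := G) n hB0.le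
      push_cast
      linarith
  obtain ⟨r, hr⟩ : ∃ r, r = Real.exp (-(2 * l * η)) := ⟨_, rfl⟩
  have hr0 : 0 < r := hr ▸ Real.exp_pos _
  have hr1 : r < 1 := by
    rw [hr, Real.exp_lt_one_iff]
    have : 0 < l * η := by positivity
    linarith
  have hsum : Summable fun n : ℕ => ((n : ℝ) ^ 1 * r ^ n) :=
    summable_pow_mul_geometric_of_norm_lt_one 1 (by rwa [Real.norm_of_nonneg hr0.le])
  have hsum1 : Summable fun n : ℕ => (((n + 1 : ℕ) : ℝ) ^ 1 * r ^ (n + 1)) :=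
    (summable_nat_add_iff 1).2 hsum
  obtain ⟨Z, hZ⟩ : ∃ Z, Z = ∑' n : ℕ, (((n + 1 : ℕ) : ℝ) ^ 1 * r ^ (n + 1)) := ⟨_, rfl⟩
  obtain ⟨M', hM', hM'ε⟩ := exists_mul_exp_le (A := B * Z) (l := 2 * l) (ε := ε / 2)
    (by positivity) (by positivity)
  have hterm : ∀ i : ℕ, killedProb G i (tailBound k b M' i)ᶜ ≤
      B * Real.exp (-(2 * l * M')) * (((i + 1 : ℕ) : ℝ) ^ 1 * r ^ (i + 1)) := by
    intro i
    refine (killedProb_le_of_one_le i (f := tailPotential k l c i)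
      (c := r ^ (i + 1) * Real.exp (-(2 * l * M')))
      (by positivity) (tailPotential_nonneg k l c i) fun T hT => ?_).trans ?_
    · have h1 : 2 * (b * (i + 1) + M') < (T.tailDeg k : ℝ) := not_le.1 hT
      simp only [tailPotential]
      rw [hr, ← Real.exp_nat_mul, ← Real.exp_add, ← Real.exp_add, ← Real.exp_add,
        Real.one_le_exp_iff]
      have h2 := mul_le_mul_of_nonneg_left h1.le hl.le
      rw [hc]
      push_cast
      linarith
    · refine (mul_le_mul_of_nonneg_left (hE i) (by positivity)).trans_eq ?_
      push_cast
      ring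
  have hH : ∀ n, ∑ i ∈ Finset.range n, killedProb G i (tailBound k b M' i)ᶜ ≤ ε / 2 := by
    intro n
    refine ((Finset.sum_le_sum fun i _ => hterm i).trans ?_).trans hM'ε
    rw [← Finset.mul_sum, mul_right_comm, hZ]
    exact mul_le_mul_of_nonneg_right
      (mul_le_mul_of_nonneg_left (hsum1.sum_le_tsum _ fun i _ => by positivity) hB0.le)
      (Real.exp_pos _).le
  have hGH := hG.and hH
  rw [add_halves] at hGH
  exact ⟨M', hM', G.and (tailBound k b M'), hGH, G.and_subset_right _⟩

/-- From degree nine on, the tail fractions are so small that squaring them beats the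
factor `k` gained when a vertex enters the tail at `k`. -/
theorem tailAtMost_nine : TailAtMost 9 (3 / 1000) := by
  have h1 := tailAtMost_one
  have h2 : TailAtMost 2 (3 / 4) := TailAtMost.succ (k := 2) le_add_self h1
    (by norm_num) (by norm_num)
  have h3 : TailAtMost 3 (11 / 20) := TailAtMost.succ (k := 3) le_add_self h2
    (by norm_num) (by norm_num)
  have h4 : TailAtMost 4 (2 / 5) := TailAtMost.succ (k := 4) le_add_self h3
    (by norm_num) (by norm_num)
  have h5 : TailAtMost 5 (27 / 100) := TailAtMost.succ (k := 5) le_add_self h4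
    (by norm_num) (by norm_num)
  have h6 : TailAtMost 6 (4 / 25) := TailAtMost.succ (k := 6) le_add_self h5
    (by norm_num) (by norm_num)
  have h7 : TailAtMost 7 (2 / 25) := TailAtMost.succ (k := 7) le_add_self h6
    (by norm_num) (by norm_num)
  have h8 : TailAtMost 8 (1 / 40) := TailAtMost.succ (k := 8) le_add_self h7
    (by norm_num) (by norm_num)
  have h9 : TailAtMost 9 (3 / 1000) := TailAtMost.succ (k := 9) le_add_self h8
    (by norm_num) (by norm_num)
  exact h9

/-! ### Doubly exponential decay of the tails -/

theorem sum_exp_neg_mul_le {x : ℝ} (hx : 0 < x) (n : ℕ) :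
    ∑ i ∈ Finset.range n, Real.exp (-(x * (i + 1))) ≤ 1 / x := by
  have hr : Real.exp (-x) * (1 + x) ≤ 1 := by
    rw [Real.exp_neg, inv_mul_le_iff₀ (Real.exp_pos x), mul_one]
    linarith [Real.add_one_le_exp x]
  have h : ∀ i : ℕ, Real.exp (-(x * (i + 1))) = Real.exp (-x) ^ i * Real.exp (-x) := fun i => by
    rw [← Real.exp_nat_mul, ← Real.exp_add]
    congr 1
    ring
  suffices h2 : ∑ i ∈ Finset.range n, Real.exp (-(x * (i + 1))) ≤
      (1 - Real.exp (-x) ^ n) * (1 / x) by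
    refine h2.trans (mul_le_of_le_one_left (by positivity) ?_)
    linarith [pow_pos (Real.exp_pos (-x)) n]
  induction n with
  | zero => simp
  | succ n ih =>
    rw [Finset.sum_range_succ, h]
    have h3 : Real.exp (-x) ≤ (1 - Real.exp (-x)) * (1 / x) := by
      rw [mul_one_div, le_div_iff₀ hx]
      linarith
    have h4 := mul_le_mul_of_nonneg_left h3 (pow_pos (Real.exp_pos (-x)) n).le
    rw [pow_succ]
    linarith

/-- The rate `1 / k` is chosen because a vertex entering the tail at `k` adds `k` to its degree. -/
theorem killedExp_exp_tailDeg_le {G : Condition} {k : ℕ} (hk : 2 ≤ k) {a M : ℝ}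
    (hM : (k : ℝ) ≤ M) (hG : ∀ n, G n ⊆ tailBound (k - 1) a M n) (n : ℕ) :
    killedExp G n (fun T => Real.exp (1 / k * T.tailDeg k)) ≤
      Real.exp (6 * M / k + 8 * a ^ 2 * (n + 1)) := by
  have hk1 : (2 : ℝ) ≤ k := by exact_mod_cast hk
  have hk0 : (0 : ℝ) < k := by linarith
  have hsmall : ∀ n : ℕ, ∀ x : ℝ, x ≤ 6 * M →
      Real.exp (1 / k * x) ≤ Real.exp (6 * M / k + 8 * a ^ 2 * (n + 1)) := by
    intro n x hx
    rw [Real.exp_le_exp, one_div_mul_eq_div]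
    have h1 : x / k ≤ 6 * M / k := by gcongr
    have h2 : 0 ≤ 8 * a ^ 2 * ((n : ℝ) + 1) := by positivity
    linarith
  induction n with
  | zero =>
    have h1 : ((singleEdge).tailDeg k : ℝ) ≤ 2 := by exact_mod_cast singleEdge.tailDeg_le k
    exact hsmall 0 _ (by linarith)
  | succ n ih =>
    -- At early times the additive term of the bound dominates.
    by_cases hn : a * (n + 1) ≤ M
    · refine killedExp_succ_le_of_le n (Real.exp_pos _).le fun T hT => ?_
      refine stepExp_le_of_le T fun y => hsmall _ _ ?_
      have h1 : (T.tailDeg (k - 1) : ℝ) ≤ 2 * (a * (n + 1) + M) := hG n hT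
      have h2 : (T.tailDeg k : ℝ) ≤ T.tailDeg (k - 1) := by
        exact_mod_cast T.tailDeg_anti (by omega)
      have h3 := tailDeg_attach_le T y hk
      linarith
    · have hstep : ∀ T ∈ G n, stepExp T (fun T' => Real.exp (1 / k * T'.tailDeg k)) ≤
          Real.exp (8 * a ^ 2) * Real.exp (1 / k * T.tailDeg k) := by
        intro T hT
        have h1 : (T.tailDeg (k - 1) : ℝ) ≤ 2 * (a * (n + 1) + M) := hG n hT
        have h2 : T.tailFrac (k - 1) ≤ 2 * a := tailFrac_le_of_tailDeg_le (by linarith)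
        have h3 : T.tailFrac (k - 1) ^ 2 ≤ (2 * a) ^ 2 :=
          pow_le_pow_left₀ (T.tailFrac_nonneg _) h2 2
        have h4 := exp_sub_one_le (x := 1) zero_le_one le_rfl
        have h5 : Real.exp (1 / k) ≤ Real.exp 1 := by
          rw [Real.exp_le_exp, div_le_one hk0]
          linarith
        have h6 := mul_nonneg (sub_nonneg.2 h5) (sq_nonneg (T.tailFrac k))
        have h7 := mul_le_mul_of_nonneg_right h4 (sq_nonneg (T.tailFrac (k - 1)))
        have h8 := Real.add_one_le_exp (8 * a ^ 2)
        rw [stepExp_exp_tailDeg T hk, one_div_mul_cancel hk0.ne', mul_comm]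
        refine mul_le_mul_of_nonneg_right ?_ (Real.exp_pos _).le
        linarith
      refine (killedExp_succ_le_of_step_le n (fun T => by positivity) hstep).trans ?_
      rw [killedExp_const_mul]
      refine (mul_le_mul_of_nonneg_left ih (Real.exp_pos _).le).trans_eq ?_
      rw [← Real.exp_add]
      congr 1
      push_cast
      ring

/-- One level of the recursion: the tail fraction gets squared, at the price of a factor `8 k`. -/
theorem sum_killedProb_tailBound_compl_le {G : Condition} {k : ℕ} (hk : 2 ≤ k) {a b M M' : ℝ}
    (hM : (k : ℝ) ≤ M) (hM' : 8 * M ≤ M') (hb : 0 < b) (hab : 8 * k * a ^ 2 ≤ b)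
    (hG : ∀ n, G n ⊆ tailBound (k - 1) a M n) (n : ℕ) :
    ∑ i ∈ Finset.range n, killedProb G i (tailBound k b M' i)ᶜ ≤
      Real.exp (-(M' / k)) * (k / b) := by
  have hk1 : (2 : ℝ) ≤ k := by exact_mod_cast hk
  have hk0 : (0 : ℝ) < k := by linarith
  have hterm : ∀ i : ℕ, killedProb G i (tailBound k b M' i)ᶜ ≤
      Real.exp (-(M' / k)) * Real.exp (-(b / k * (i + 1))) := by
    intro i
    refine (killedProb_le_of_one_le i (f := fun T => Real.exp (1 / k * T.tailDeg k))
      (c := Real.exp (-(2 * (b * (i + 1) + M') / k))) (by positivity) (fun T => by positivity)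
      fun T hT => ?_).trans ?_
    · have h1 : 2 * (b * (i + 1) + M') < (T.tailDeg k : ℝ) := not_le.1 hT
      rw [← Real.exp_add, Real.one_le_exp_iff, one_div_mul_eq_div]
      have h2 : 2 * (b * (i + 1) + M') / k ≤ (T.tailDeg k : ℝ) / k := by gcongr
      linarith
    · refine (mul_le_mul_of_nonneg_left (killedExp_exp_tailDeg_le hk hM hG i)
        (Real.exp_pos _).le).trans ?_
      rw [← Real.exp_add, ← Real.exp_add, Real.exp_le_exp]
      have h1 : 8 * a ^ 2 ≤ b / k := by
        rw [le_div_iff₀ hk0]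
        linarith
      have h2 := mul_le_mul_of_nonneg_right h1 (by positivity : (0 : ℝ) ≤ (i : ℝ) + 1)
      have h3 : 6 * M / k ≤ M' / k := by
        gcongr
        linarith
      have h4 : 2 * (b * (i + 1) + M') / k = 2 * (b / k * (i + 1)) + 2 * (M' / k) := by ring
      rw [h4]
      linarith
  refine (Finset.sum_le_sum fun i _ => hterm i).trans ?_
  rw [← Finset.mul_sum]
  refine mul_le_mul_of_nonneg_left ?_ (Real.exp_pos _).le
  refine (sum_exp_neg_mul_le (by positivity) n).trans_eq ?_
  rw [one_div_div]

/-- The bound for the tail fraction at degree `9 + j`. The denominator makes the sequence absorb the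
factor `8 k` of the recursion, see `upperFrac_succ`; its first value `1 / 198` exceeds
`3 / 1000`. -/
noncomputable def upperFrac (j : ℕ) : ℝ := (1 / 2) ^ 2 ^ j / (11 * (9 + j))

theorem upperFrac_pos (j : ℕ) : 0 < upperFrac j := by
  unfold upperFrac
  positivity

theorem upperFrac_succ (j : ℕ) :
    8 * ((9 + (j + 1) : ℕ) : ℝ) * upperFrac j ^ 2 ≤ upperFrac (j + 1) := by
  unfold upperFrac
  have hj : (0 : ℝ) ≤ j := Nat.cast_nonneg j
  rw [div_pow, ← pow_mul, ← pow_succ, mul_div_assoc', mul_comm, ← mul_div_assoc', div_eq_mul_inv]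
  refine mul_le_mul_of_nonneg_left ?_ (by positivity)
  rw [div_le_iff₀ (by positivity), ← div_eq_inv_mul, le_div_iff₀ (by positivity)]
  push_cast
  nlinarith

/-- The additive errors `10 L 8 ^ j` outweigh the doubly exponential factor `1 / upperFrac (j + 1)`
in the error bound, and make the sum of the errors over all levels at most of the order `1 / L`. -/
theorem upper_level_error_le {L : ℝ} (hL : 1 ≤ L) (j : ℕ) :
    Real.exp (-(10 * L * 8 ^ (j + 1) / ((9 + (j + 1) : ℕ) : ℝ))) *
      (((9 + (j + 1) : ℕ) : ℝ) / upperFrac (j + 1)) ≤ 1100 * Real.exp (-(L * (j + 1))) := by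
  have hj : ((9 + (j + 1) : ℕ) : ℝ) ≤ 10 * 2 ^ j := by
    have : j < 2 ^ j := Nat.lt_two_pow_self
    norm_cast
    omega
  obtain ⟨k, hk⟩ : ∃ k : ℝ, k = ((9 + (j + 1) : ℕ) : ℝ) := ⟨_, rfl⟩
  have hk0 : 0 < k := by
    rw [hk]
    positivity
  have hk' : (9 : ℝ) + ((j + 1 : ℕ) : ℝ) = k := by
    rw [hk]
    push_cast
    ring
  obtain ⟨w, hw⟩ : ∃ w : ℝ, w = 4 ^ j := ⟨_, rfl⟩
  have hw1 : (j : ℝ) + 1 ≤ w := by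
    rw [hw]
    have : j < 4 ^ j := Nat.lt_pow_self (by norm_num)
    exact_mod_cast this
  have h2w : (2 : ℝ) ^ j * 2 ^ j = w := by
    rw [hw, ← mul_pow]
    norm_num
  have h2le : (2 : ℝ) ^ j ≤ w := by
    rw [hw]
    exact pow_le_pow_left₀ (by norm_num) (by norm_num) j
  have h8 : (8 : ℝ) ^ (j + 1) = 8 * w * 2 ^ j := by
    rw [hw, pow_succ, mul_assoc, ← mul_pow]
    norm_num
    ring
  rw [upperFrac, hk', ← hk]
  rw [← hk] at hj
  have hw0 : 0 < w := by
    rw [hw]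
    positivity
  have h1 : 8 * L * w ≤ 10 * L * 8 ^ (j + 1) / k := by
    rw [le_div_iff₀ hk0, h8]
    have := mul_le_mul_of_nonneg_left hj (by positivity : 0 ≤ 8 * L * w)
    linarith
  have hpow : ((1 / 2 : ℝ) ^ 2 ^ (j + 1))⁻¹ ≤ Real.exp (2 * w) := by
    rw [← inv_pow, one_div, inv_inv]
    have h3 : (2 : ℝ) ≤ Real.exp 1 := by linarith [Real.add_one_le_exp (1 : ℝ)]
    calc (2 : ℝ) ^ 2 ^ (j + 1) ≤ Real.exp 1 ^ 2 ^ (j + 1) := pow_le_pow_left₀ (by norm_num) h3 _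
      _ = Real.exp (2 * 2 ^ j) := by
        rw [← Real.exp_nat_mul]
        push_cast
        congr 1
        ring
      _ ≤ Real.exp (2 * w) := by
        rw [Real.exp_le_exp]
        linarith
  have hkk : k * k ≤ 100 * Real.exp w := by
    have h4 := mul_le_mul hj hj hk0.le (by positivity)
    have h5 := Real.add_one_le_exp w
    nlinarith
  have h6 : k / ((1 / 2 : ℝ) ^ 2 ^ (j + 1) / (11 * k)) =
      11 * (k * k) * ((1 / 2 : ℝ) ^ 2 ^ (j + 1))⁻¹ := by
    rw [div_div_eq_mul_div, div_eq_mul_inv]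
    ring
  rw [h6]
  calc Real.exp (-(10 * L * 8 ^ (j + 1) / k)) * (11 * (k * k) * ((1 / 2 : ℝ) ^ 2 ^ (j + 1))⁻¹)
      ≤ Real.exp (-(8 * L * w)) * (11 * (100 * Real.exp w) * Real.exp (2 * w)) := by
        gcongr
    _ = 1100 * Real.exp (-(8 * L * w) + w + 2 * w) := by
        rw [Real.exp_add, Real.exp_add]
        ring
    _ ≤ 1100 * Real.exp (-(L * (j + 1))) := by
        have h7 : 0 ≤ L * (w - (j + 1)) := mul_nonneg (by linarith) (by linarith)
        have h9 : 0 ≤ (L - 1) * w := mul_nonneg (by linarith) (by linarith)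
        gcongr
        linarith

/-- With probability close to one, the doubly exponential bounds for the tails hold at all times
and at any given number of levels, with errors that depend on neither. -/
theorem exists_upper_condition {ε : ℝ} (hε : 0 < ε) :
    ∃ M > 0, ∀ J : ℕ, ∃ G : Condition, FailsLE G ε ∧
      ∀ j ≤ J, ∀ n, G n ⊆ tailBound (9 + j) (upperFrac j) (M * 8 ^ j) n := by
  obtain ⟨M₀, hM₀, G₀, hG₀, hGM₀⟩ := tailAtMost_nine (ε / 2) (by positivity)
  obtain ⟨L, hL1, hLε, hLM⟩ : ∃ L : ℝ, 1 ≤ L ∧ 2200 / ε ≤ L ∧ M₀ ≤ 10 * L := by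
    refine ⟨max 1 (max (2200 / ε) M₀), le_max_left _ _,
      (le_max_left _ _).trans (le_max_right _ _), ?_⟩
    have h1 := (le_max_right (2200 / ε) M₀).trans (le_max_right 1 _)
    linarith
  have key : ∀ J : ℕ, ∃ G : Condition,
      FailsLE G (ε / 2 + ∑ j ∈ Finset.range J, 1100 * Real.exp (-(L * (j + 1)))) ∧
      ∀ j ≤ J, ∀ n, G n ⊆ tailBound (9 + j) (upperFrac j) (10 * L * 8 ^ j) n := by
    intro J
    induction J with
    | zero =>
      refine ⟨G₀, by simpa using hG₀, fun j hj n T hT => ?_⟩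
      obtain rfl : j = 0 := by omega
      have h1 : (T.tailDeg 9 : ℝ) ≤ 2 * (3 / 1000 * (n + 1) + M₀) := hGM₀ n hT
      have h2 : upperFrac 0 = 1 / 198 := by
        rw [upperFrac]
        norm_num
      change (T.tailDeg 9 : ℝ) ≤ 2 * (upperFrac 0 * (n + 1) + 10 * L * 8 ^ 0)
      rw [h2]
      have h3 : (0 : ℝ) ≤ n := Nat.cast_nonneg n
      linarith
    | succ J ih =>
      obtain ⟨G, hG, hGJ⟩ := ih
      have hM : ((9 + (J + 1) : ℕ) : ℝ) ≤ 10 * L * 8 ^ J := by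
        have h1 : J < 8 ^ J := Nat.lt_pow_self (by norm_num)
        have h2 : ((9 + (J + 1) : ℕ) : ℝ) ≤ 10 * 8 ^ J := by
          norm_cast
          omega
        have h3 : (0 : ℝ) < 8 ^ J := by positivity
        nlinarith
      have hH := fun n => (sum_killedProb_tailBound_compl_le (by omega) hM
        (M' := 10 * L * 8 ^ (J + 1)) (by rw [pow_succ]; linarith) (upperFrac_pos (J + 1))
        (upperFrac_succ J) (hGJ J le_rfl) n).trans (upper_level_error_le hL1 J)
      refine ⟨G.and (tailBound (9 + (J + 1)) (upperFrac (J + 1)) (10 * L * 8 ^ (J + 1))), ?_, ?_⟩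
      · rw [Finset.sum_range_succ, ← add_assoc (ε / 2)]
        exact hG.and hH
      · intro j hj n
        rcases Nat.lt_or_ge J j with h | h
        · obtain rfl : j = J + 1 := by omega
          exact Condition.and_subset_right _ _ n
        · exact (Condition.and_subset_left _ _ n).trans (hGJ j h n)
  refine ⟨10 * L, by positivity, fun J => ?_⟩
  obtain ⟨G, hG, hGJ⟩ := key J
  refine ⟨G, fun n => (hG n).trans ?_, hGJ⟩
  rw [← Finset.mul_sum]
  have h1 := sum_exp_neg_mul_le (by linarith : 0 < L) J
  have h2 : 1100 * (1 / L) ≤ ε / 2 := by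
    rw [mul_one_div, div_le_iff₀ (by linarith)]
    rw [div_le_iff₀ hε] at hLε
    linarith
  linarith

/-! ### The upper bound for the maximum degree -/

theorem exists_pow_four_le (M : ℝ) :
    ∃ j₀ : ℕ, ∀ j ≥ j₀, (1 + M * 8 ^ (j + 1)) ^ 4 ≤ (2 : ℝ) ^ 2 ^ j := by
  have h1 : Tendsto (fun j : ℕ => (1 + |M| * 8) ^ 4 *
      (((2 ^ j : ℕ) : ℝ) ^ 12 / (2 : ℝ) ^ (2 ^ j : ℕ))) atTop (𝓝 ((1 + |M| * 8) ^ 4 * 0)) :=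
    ((tendsto_pow_const_div_const_pow_of_one_lt 12 (by norm_num : (1 : ℝ) < 2)).comp
      (tendsto_pow_atTop_atTop_of_one_lt (by norm_num : 1 < 2))).const_mul _
  rw [mul_zero] at h1
  obtain ⟨j₀, hj₀⟩ := eventually_atTop.1 (h1.eventually (gt_mem_nhds zero_lt_one))
  refine ⟨j₀, fun j hj => ?_⟩
  have h2 := hj₀ j hj
  rw [← mul_div_assoc, div_lt_one (by positivity)] at h2
  refine le_trans ?_ h2.le
  have h3 : (((2 ^ j : ℕ) : ℝ) ^ 12) = (8 ^ j) ^ 4 := by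
    push_cast
    rw [← pow_mul, ← pow_mul, mul_comm j 12, mul_comm j 4, pow_mul, pow_mul]
    norm_num
  rw [h3, ← mul_pow, ← (by decide : Even 4).pow_abs (1 + M * 8 ^ (j + 1))]
  refine pow_le_pow_left₀ (abs_nonneg _) ?_ 4
  refine (abs_add_le _ _).trans ?_
  rw [abs_one, abs_mul, abs_of_pos (by positivity : (0 : ℝ) < 8 ^ (j + 1)), pow_succ]
  have h4 : (1 : ℝ) ≤ 8 ^ j := one_le_pow₀ (by norm_num)
  linarith

theorem upperFrac_le (j : ℕ) : upperFrac j ≤ 1 / 2 ^ 2 ^ j := by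
  unfold upperFrac
  rw [one_div_pow]
  refine div_le_self (by positivity) ?_
  have : (0 : ℝ) ≤ j := Nat.cast_nonneg j
  linarith

theorem sq_div_sq_le_rpow {x t : ℝ} (ht : 0 < t) (h : x ^ 4 ≤ t) :
    (x / t) ^ 2 ≤ t ^ (-(3 / 2) : ℝ) := by
  have h1 : x ^ 2 ≤ t ^ (1 / 2 : ℝ) := by
    rw [← Real.sqrt_eq_rpow]
    exact Real.le_sqrt_of_sq_le (by rwa [← pow_mul])
  rw [div_pow, div_le_iff₀ (by positivity), ← Real.rpow_natCast t 2, ← Real.rpow_add ht]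
  norm_num
  simpa using h1

/-- Among the bounds at the levels up to `J`, the one at the first level `j` with
`t ≤ 2 ^ 2 ^ j` shows that the tail fraction at time `t` is at most `t ^ (-3/4)`. -/
theorem exists_tailFrac_sq_le (M : ℝ) :
    ∃ t₀ : ℕ, ∀ n ≥ t₀, ∀ J : ℕ, ((n : ℝ) + 1) ≤ 2 ^ 2 ^ J → ∀ T : LabelledTree (n + 1),
      (∀ j ≤ J, T ∈ tailBound (9 + j) (upperFrac j) (M * 8 ^ j) n) →
      T.tailFrac (9 + J) ^ 2 ≤ ((n : ℝ) + 1) ^ (-(3 / 2) : ℝ) := by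
  obtain ⟨j₀, hj₀⟩ := exists_pow_four_le M
  refine ⟨2 ^ 2 ^ j₀, fun n hn J hJ T hT => ?_⟩
  have ht : (0 : ℝ) < (n : ℝ) + 1 := by positivity
  classical
  have hex : ∃ j : ℕ, ((n : ℝ) + 1) ≤ 2 ^ 2 ^ j := ⟨J, hJ⟩
  obtain ⟨j, hj1, hj2, hj3⟩ : ∃ j ≤ J, ((n : ℝ) + 1) ≤ 2 ^ 2 ^ j ∧
      ∀ i < j, (2 : ℝ) ^ 2 ^ i < (n : ℝ) + 1 :=
    ⟨Nat.find hex, Nat.find_min' hex hJ, Nat.find_spec hex,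
      fun i hi => not_le.1 (Nat.find_min hex hi)⟩
  have hjj : j₀ < j := by
    by_contra hc
    have h1 : (2 : ℝ) ^ 2 ^ j ≤ 2 ^ 2 ^ j₀ :=
      pow_le_pow_right₀ (by norm_num) (Nat.pow_le_pow_right (by norm_num) (not_lt.1 hc))
    have h2 : (2 : ℝ) ^ 2 ^ j₀ ≤ n := by exact_mod_cast hn
    linarith
  obtain ⟨i, rfl⟩ : ∃ i, j = i + 1 := ⟨j - 1, by omega⟩
  have h4 : (1 + M * 8 ^ (i + 1)) ^ 4 ≤ (n : ℝ) + 1 :=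
    (hj₀ i (by omega)).trans (hj3 i (by omega)).le
  refine le_trans (pow_le_pow_left₀ (T.tailFrac_nonneg _) ?_ 2) (sq_div_sq_le_rpow ht h4)
  refine (T.tailFrac_anti (by omega : 9 + (i + 1) ≤ 9 + J)).trans (tailFrac_le_of_tailDeg_le ?_)
  have h5 : (T.tailDeg (9 + (i + 1)) : ℝ) ≤
    2 * (upperFrac (i + 1) * (n + 1) + M * 8 ^ (i + 1)) := hT (i + 1) hj1
  have h6 : upperFrac (i + 1) * ((n : ℝ) + 1) ≤ 1 := by
    refine (mul_le_mul_of_nonneg_right (upperFrac_le _) ht.le).trans ?_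
    rw [one_div_mul_eq_div]
    exact div_le_one_of_le₀ hj2 (by positivity)
  rw [div_mul_cancel₀ _ ht.ne']
  linarith

theorem exists_sum_rpow_le {ε : ℝ} (hε : 0 < ε) :
    ∃ t₀ : ℕ, ∀ t ≥ t₀, ∀ d : ℕ,
      ∑ i ∈ Finset.range d, (((t + i : ℕ) : ℝ) + 1) ^ (-(3 / 2) : ℝ) ≤ ε := by
  have hs : Summable fun n : ℕ => ((n : ℝ) + 1) ^ (-(3 / 2) : ℝ) := by
    have h := (summable_nat_add_iff 1).2 (Real.summable_nat_rpow (p := -(3 / 2)).2 (by norm_num))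
    simpa using h
  have h1 := tendsto_sum_nat_add fun n : ℕ => ((n : ℝ) + 1) ^ (-(3 / 2) : ℝ)
  obtain ⟨t₀, ht₀⟩ := eventually_atTop.1 (h1.eventually (gt_mem_nhds hε))
  refine ⟨t₀, fun t ht d => le_trans ?_ (ht₀ t ht).le⟩
  simp_rw [add_comm t]
  exact ((summable_nat_add_iff t).2 hs).sum_le_tsum _ fun i _ => by positivity

theorem killedProb_tailDeg_pos_eq_zero (G : Condition) {n k : ℕ} (h : n + 1 < k) :
    killedProb G n {T | 0 < T.tailDeg k} = 0 := by
  have h1 : {T : LabelledTree (n + 1) | 0 < T.tailDeg k} = ∅ := by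
    ext T
    simp only [Set.mem_ofPred_eq, Set.mem_empty_iff_false, iff_false]
    rw [T.tailDeg_pos_iff (by omega)]
    have := T.maxDeg_le
    omega
  rw [h1, killedProb, Set.indicator_empty]
  refine le_antisymm (killedExp_le_of_le n le_rfl fun _ => le_rfl)
    (killedExp_nonneg n fun _ => le_rfl)

/-- With probability close to one no vertex reaches degree `10 + J` before time `2 ^ 2 ^ J`: up to
a fixed time this is impossible, and afterwards the probability of such an event at time `t` is
at most `t ^ (-3/2)`. -/
theorem exists_upper_bound {ε : ℝ} (hε : 0 < ε) :
    ∃ J₀ : ℕ, ∀ J ≥ J₀, ∀ n : ℕ, ((n : ℝ) + 1) ≤ 2 ^ 2 ^ J →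
      killedProb Condition.all n {T | 0 < T.tailDeg (9 + J + 1)} ≤ ε := by
  obtain ⟨M, -, hM⟩ := exists_upper_condition (ε := ε / 2) (by positivity)
  obtain ⟨t₁, ht₁⟩ := exists_tailFrac_sq_le M
  obtain ⟨t₂, ht₂⟩ := exists_sum_rpow_le (ε := ε / 2) (by positivity)
  refine ⟨max t₁ t₂, fun J hJ n hn => ?_⟩
  obtain ⟨t, ht⟩ : ∃ t, t = max t₁ t₂ := ⟨_, rfl⟩
  rw [← ht] at hJ
  obtain ⟨G, hG, hGJ⟩ := hM J
  rcases Nat.lt_or_ge n t with hnt | hnt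
  · rw [killedProb_tailDeg_pos_eq_zero _ (by omega)]
    exact hε.le
  have key : ∀ d : ℕ, t + d ≤ n → killedProb G (t + d) {T | 0 < T.tailDeg (9 + J + 1)} ≤
      ∑ i ∈ Finset.range d, (((t + i : ℕ) : ℝ) + 1) ^ (-(3 / 2) : ℝ) := by
    intro d
    induction d with
    | zero =>
      intro _
      rw [Finset.sum_range_zero]
      exact (killedProb_tailDeg_pos_eq_zero G (by omega)).le
    | succ d ih =>
      intro hd
      rw [Finset.sum_range_succ]
      have h1 := ih (by omega)
      obtain ⟨s, hs⟩ : ∃ s : ℝ, s = (((t + d : ℕ) : ℝ) + 1) ^ (-(3 / 2) : ℝ) := ⟨_, rfl⟩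
      have hs0 : 0 ≤ s := by
        rw [hs]
        positivity
      have hle : (((t + d : ℕ) : ℝ) + 1) ≤ 2 ^ 2 ^ J := by
        refine le_trans ?_ hn
        have : ((t + d : ℕ) : ℝ) ≤ n := by exact_mod_cast (by omega : t + d ≤ n)
        linarith
      have hstep : ∀ T ∈ G (t + d),
          stepExp T (Set.indicator {T' | 0 < T'.tailDeg (9 + J + 1)} 1) ≤
            Set.indicator {T | 0 < T.tailDeg (9 + J + 1)} 1 T + s := by
        intro T hT
        have h2 := stepExp_tailDeg_pos_le T (k := 9 + J + 1) (by omega)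
        have h3 := ht₁ (t + d) (by omega) J hle T fun j hj => hGJ j hj _ hT
        rw [hs]
        exact h2.trans (add_le_add_right h3 _)
      have h5 := killedExp_succ_le_of_step_le (t + d)
        (fun T => add_nonneg (indicator_one_nonneg _ T) hs0) hstep
      rw [killedExp_add] at h5
      have h6 := killedExp_const_le (G := G) (t + d) hs0
      rw [← hs]
      exact h5.trans (add_le_add h1 h6)
  have h1 := key (n - t) (by omega)
  rw [Nat.add_sub_cancel' hnt] at h1
  have h2 := killedProb_all_le (G := G) n {T | 0 < T.tailDeg (9 + J + 1)}
  have h3 := ht₂ t (by omega) (n - t)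
  have h4 := hG n
  linarith

/-! ### The lower bound for the maximum degree -/

/-- The condition that from time `t` on the tail of the degrees at `k` has at least the fraction
`c` of the total degree. -/
def lowerBound (k : ℕ) (c t : ℝ) : Condition := fun n =>
  {T | t ≤ n + 1 → 2 * (c * (n + 1)) ≤ (T.tailDeg k : ℝ)}

/-- Choosing a vertex of degree at least `k - 1` increases the tail degree at `k`. -/
theorem stepExp_exp_neg_tailDeg_le {m : ℕ} [NeZero m] (T : LabelledTree m) {k : ℕ} (hk : 2 ≤ k) :
    stepExp T (fun T' => Real.exp (-1 * T'.tailDeg k)) ≤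
      Real.exp (-(T.tailFrac (k - 1) ^ 2 / 2)) * Real.exp (-1 * T.tailDeg k) := by
  rw [stepExp_exp_tailDeg T hk, mul_comm]
  refine mul_le_mul_of_nonneg_right ?_ (Real.exp_pos _).le
  have hk1 : (2 : ℝ) ≤ k := by exact_mod_cast hk
  have h1 : T.tailFrac k ^ 2 ≤ T.tailFrac (k - 1) ^ 2 :=
    pow_le_pow_left₀ (T.tailFrac_nonneg _) (T.tailFrac_anti (by omega)) 2
  have h2 : Real.exp (-1 * k) ≤ Real.exp (-1) := by
    rw [Real.exp_le_exp]
    linarith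
  have h3 : Real.exp (-1) ≤ 1 / 2 := by
    rw [Real.exp_neg, one_div]
    refine inv_anti₀ (by norm_num) ?_
    linarith [Real.add_one_le_exp (1 : ℝ)]
  have h4 := mul_le_mul_of_nonneg_left h1 (sub_nonneg.2 h2)
  have h5 := mul_le_mul_of_nonneg_right h3 (sq_nonneg (T.tailFrac (k - 1)))
  have h6 := Real.add_one_le_exp (-(T.tailFrac (k - 1) ^ 2 / 2))
  linarith

theorem killedExp_exp_neg_tailDeg_le {G : Condition} {k : ℕ} (hk : 2 ≤ k) {c t : ℝ}
    (hc : 0 ≤ c) (ht : 0 ≤ t) (hG : ∀ n, G n ⊆ lowerBound (k - 1) c t n) (n : ℕ) :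
    killedExp G n (fun T => Real.exp (-1 * T.tailDeg k)) ≤ Real.exp ((t - n) * (c ^ 2 / 2)) := by
  have hle : ∀ {m : ℕ} (T : LabelledTree m), Real.exp (-1 * T.tailDeg k) ≤ 1 := fun T => by
    rw [Real.exp_le_one_iff]
    have : (0 : ℝ) ≤ T.tailDeg k := Nat.cast_nonneg _
    linarith
  induction n with
  | zero =>
    refine (hle singleEdge).trans ?_
    rw [Real.one_le_exp_iff]
    push_cast
    rw [sub_zero]
    positivity
  | succ n ih =>
    rcases lt_or_ge ((n : ℝ) + 1) t with h | h
    · refine killedExp_succ_le_of_le n (Real.exp_pos _).le fun T _ =>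
        stepExp_le_of_le T fun y => (hle _).trans ?_
      rw [Real.one_le_exp_iff]
      refine mul_nonneg ?_ (by positivity)
      push_cast
      linarith
    · have hstep : ∀ T ∈ G n, stepExp T (fun T' => Real.exp (-1 * T'.tailDeg k)) ≤
          Real.exp (-(c ^ 2 / 2)) * Real.exp (-1 * T.tailDeg k) := by
        intro T hT
        have h1 : c ≤ T.tailFrac (k - 1) := le_tailFrac_of_le_tailDeg (hG n hT h)
        have h2 : c ^ 2 ≤ T.tailFrac (k - 1) ^ 2 := pow_le_pow_left₀ hc h1 2
        refine (stepExp_exp_neg_tailDeg_le T hk).trans ?_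
        refine mul_le_mul_of_nonneg_right ?_ (Real.exp_pos _).le
        rw [Real.exp_le_exp]
        linarith
      refine (killedExp_succ_le_of_step_le n (fun T => by positivity) hstep).trans ?_
      rw [killedExp_const_mul]
      refine (mul_le_mul_of_nonneg_left ih (Real.exp_pos _).le).trans_eq ?_
      rw [← Real.exp_add]
      congr 1
      push_cast
      ring

/-- One level of the recursion: after twice the time, the tail fraction is at least the square of
the previous one, up to a constant factor. -/
theorem sum_killedProb_lowerBound_compl_le {G : Condition} {k : ℕ} (hk : 2 ≤ k) {c t t' : ℝ}
    (hc : 0 < c) (ht : 0 ≤ t) (ht' : 2 * (t + 1) ≤ t')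
    (hG : ∀ n, G n ⊆ lowerBound (k - 1) c t n) (n : ℕ) :
    ∑ i ∈ Finset.range n, killedProb G i (lowerBound k (c ^ 2 / 16) t' i)ᶜ ≤
      Real.exp (-(c ^ 2 / 16 * t')) * (1 / (c ^ 2 / 16)) := by
  obtain ⟨b, hb⟩ : ∃ b, b = c ^ 2 / 16 := ⟨_, rfl⟩
  have hb0 : 0 < b := by
    rw [hb]
    positivity
  rw [← hb]
  have hterm : ∀ i : ℕ, killedProb G i (lowerBound k b t' i)ᶜ ≤
      Real.exp (-(b * t')) * Real.exp (-(b * (i + 1))) := by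
    intro i
    rcases lt_or_ge ((i : ℝ) + 1) t' with h | h
    · have h1 : (lowerBound k b t' i)ᶜ = ∅ := by
        rw [Set.compl_empty_iff, Set.eq_univ_iff_forall]
        exact fun T hT => absurd hT (not_le.2 h)
      rw [h1, killedProb, Set.indicator_empty]
      exact killedExp_le_of_le i (by positivity) fun _ => by positivity
    refine (killedProb_le_of_one_le i (f := fun T => Real.exp (-1 * T.tailDeg k))
      (c := Real.exp (2 * (b * (i + 1)))) (by positivity) (fun T => by positivity)
      fun T hT => ?_).trans ?_
    · have h1 : (T.tailDeg k : ℝ) < 2 * (b * (i + 1)) := by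
        by_contra hcon
        exact hT fun _ => not_lt.1 hcon
      rw [← Real.exp_add, Real.one_le_exp_iff]
      linarith
    · refine (mul_le_mul_of_nonneg_left (killedExp_exp_neg_tailDeg_le hk hc.le ht hG i)
        (Real.exp_pos _).le).trans ?_
      rw [← Real.exp_add, ← Real.exp_add, Real.exp_le_exp]
      have h1 : c ^ 2 / 2 = 8 * b := by
        rw [hb]
        ring
      rw [h1]
      have h2 : 0 ≤ b * ((i : ℝ) + 1 - 2 * (t + 1)) := mul_nonneg hb0.le (by linarith)
      have h3 : 0 ≤ b * ((i : ℝ) + 1 - t') := mul_nonneg hb0.le (by linarith)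
      linarith
  refine (Finset.sum_le_sum fun i _ => hterm i).trans ?_
  rw [← Finset.mul_sum]
  exact mul_le_mul_of_nonneg_left (sum_exp_neg_mul_le hb0 n) (Real.exp_pos _).le

/-- The lower bound for the tail fraction at degree `1 + j`: the solution of `c' = c ^ 2 / 16`
starting from one. -/
noncomputable def lowerFrac (j : ℕ) : ℝ := 16 * (1 / 16) ^ 2 ^ j

theorem lowerFrac_zero : lowerFrac 0 = 1 := by
  norm_num [lowerFrac]

theorem lowerFrac_pos (j : ℕ) : 0 < lowerFrac j := by
  unfold lowerFrac
  positivity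

theorem lowerFrac_succ (j : ℕ) : lowerFrac (j + 1) = lowerFrac j ^ 2 / 16 := by
  unfold lowerFrac
  rw [mul_pow, ← pow_mul, ← pow_succ]
  ring

theorem lowerFrac_le_one (j : ℕ) : lowerFrac j ≤ 1 := by
  induction j with
  | zero => exact lowerFrac_zero.le
  | succ j ih =>
    rw [lowerFrac_succ]
    have := pow_le_one₀ (lowerFrac_pos j).le ih (n := 2)
    linarith

theorem lower_level_error_le {N x : ℝ} (hN : 1 ≤ N) (hx : 0 < x) (hx1 : x ≤ 1) :
    Real.exp (-(x * (N / x ^ 2))) * (1 / x) ≤ Real.exp (-N) := by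
  have h1 : x * (N / x ^ 2) = N * (1 / x) := by
    field_simp
  rw [h1]
  have h2 : 1 ≤ 1 / x := by rwa [le_div_iff₀ hx, one_mul]
  obtain ⟨y, hy⟩ : ∃ y, y = 1 / x := ⟨_, rfl⟩
  rw [← hy] at h2 ⊢
  have h3 : y ≤ Real.exp (y - 1) := by linarith [Real.add_one_le_exp (y - 1)]
  refine (mul_le_mul_of_nonneg_left h3 (Real.exp_pos _).le).trans ?_
  rw [← Real.exp_add, Real.exp_le_exp]
  nlinarith

theorem lower_time_le {N x : ℝ} (hN : 1 ≤ N) (hx : 0 < x) (hx1 : x ≤ 1) :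
    2 * (N / x ^ 2 + 1) ≤ N / (x ^ 2 / 16) ^ 2 := by
  obtain ⟨y, hy⟩ : ∃ y, y = 1 / x ^ 2 := ⟨_, rfl⟩
  have hy1 : 1 ≤ y := by
    rw [hy, le_div_iff₀ (by positivity), one_mul]
    exact pow_le_one₀ hx.le hx1
  have h1 : N / x ^ 2 = N * y := by rw [hy, mul_one_div]
  have h2 : N / (x ^ 2 / 16) ^ 2 = 256 * N * y ^ 2 := by
    rw [hy]
    field_simp
    norm_num
  rw [h1, h2]
  have h3 : 1 ≤ N * y := by nlinarith
  nlinarith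

/-- With probability close to one, the lower bound at level `J` holds from time
`N / lowerFrac J ^ 2` on. -/
theorem exists_lower_condition {N : ℝ} (hN : 1 ≤ N) (J : ℕ) :
    ∃ G : Condition, FailsLE G (J * Real.exp (-N)) ∧
      ∀ n, G n ⊆ lowerBound (1 + J) (lowerFrac J) (N / lowerFrac J ^ 2) n := by
  induction J with
  | zero =>
    refine ⟨Condition.all, by simpa using failsLE_all, fun n T _ _ => ?_⟩
    rw [lowerFrac_zero]
    change _ ≤ (T.tailDeg 1 : ℝ)
    rw [T.tailDeg_one]
    push_cast
    linarith
  | succ J ih =>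
    obtain ⟨G, hG, hGJ⟩ := ih
    have hp := lowerFrac_pos J
    have h1 := lowerFrac_le_one J
    have hH := fun n => (sum_killedProb_lowerBound_compl_le (k := 1 + (J + 1)) (by omega) hp
      (by positivity) (lower_time_le hN hp h1) hGJ n)
    rw [← lowerFrac_succ] at hH
    have hH' := fun n => (hH n).trans
      (lower_level_error_le hN (lowerFrac_pos (J + 1)) (lowerFrac_le_one (J + 1)))
    refine ⟨G.and (lowerBound (1 + (J + 1)) (lowerFrac (J + 1)) (N / lowerFrac (J + 1) ^ 2)),
      ?_, Condition.and_subset_right _ _⟩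
    have h2 := hG.and hH'
    have h3 : ((J + 1 : ℕ) : ℝ) * Real.exp (-N) = J * Real.exp (-N) + Real.exp (-N) := by
      push_cast
      ring
    rw [h3]
    exact h2

theorem killedProb_tailDeg_eq_zero_le {N : ℝ} (hN : 1 ≤ N) (J n : ℕ)
    (hn : N / lowerFrac J ^ 2 ≤ n + 1) :
    killedProb Condition.all n {T | ¬ 0 < T.tailDeg (1 + J)} ≤ J * Real.exp (-N) := by
  obtain ⟨G, hG, hGJ⟩ := exists_lower_condition hN J
  refine (killedProb_all_le (G := G) n _).trans ?_
  have h1 : killedProb G n {T | ¬ 0 < T.tailDeg (1 + J)} ≤ killedProb G n (G n)ᶜ := by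
    refine killedProb_mono n fun T hT hTG => hT ?_
    have h2 : 2 * (lowerFrac J * (n + 1)) ≤ (T.tailDeg (1 + J) : ℝ) := hGJ n hTG hn
    have h3 : 0 < 2 * (lowerFrac J * ((n : ℝ) + 1)) := by
      have := lowerFrac_pos J
      positivity
    exact_mod_cast h3.trans_le h2
  have h2 := hG (n + 1)
  rw [Finset.sum_range_succ] at h2
  linarith

/-! ### Conclusion -/

theorem killedExp_all_const (n : ℕ) (c : ℝ) : killedExp Condition.all n (fun _ => c) = c := by
  induction n with
  | zero => rfl
  | succ n ih =>
    rw [killedExp_all_succ]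
    simp only [stepExp_const]
    exact ih

theorem killedProb_all_univ (n : ℕ) : killedProb Condition.all n Set.univ = 1 := by
  rw [killedProb, Set.indicator_univ]
  exact killedExp_all_const n 1

theorem two_rpow_loglog {x : ℝ} (hx : 0 < Real.log x) :
    (2 : ℝ) ^ (Real.log (Real.log x) / Real.log 2) = Real.log x := by
  rw [Real.rpow_def_of_pos (by norm_num), mul_div_cancel₀ _ (Real.log_pos (by norm_num)).ne',
    Real.exp_log hx]

theorem le_two_pow_two_pow {x : ℝ} (hx : 1 < x) {J : ℕ}
    (hJ : Real.log (Real.log x) / Real.log 2 + 1 ≤ J) : x ≤ 2 ^ 2 ^ J := by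
  have hl := Real.log_pos hx
  have h1 : 2 * Real.log x ≤ 2 ^ J := by
    rw [← Real.rpow_natCast 2 J, ← two_rpow_loglog hl, mul_comm,
      ← Real.rpow_add_one (by norm_num)]
    exact Real.rpow_le_rpow_of_exponent_le (by norm_num) hJ
  rw [← Real.log_le_log_iff (by linarith) (by positivity), Real.log_pow]
  push_cast
  have h2 := Real.log_two_gt_d9
  nlinarith

theorem sqrt_div_lowerFrac_sq_le {x : ℝ} (hx : 1 < x) {J : ℕ}
    (hJ : (J : ℝ) + 4 ≤ Real.log (Real.log x) / Real.log 2) :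
    Real.sqrt x / lowerFrac J ^ 2 ≤ x ∧ (J : ℝ) ≤ 2 * Real.sqrt x := by
  have hl := Real.log_pos hx
  have hx0 : 0 < x := by linarith
  have h1 : 16 * (2 : ℝ) ^ J ≤ Real.log x := by
    rw [← two_rpow_loglog hl]
    refine le_trans (le_of_eq ?_) (Real.rpow_le_rpow_of_exponent_le (by norm_num) hJ)
    rw [Real.rpow_add (by norm_num), Real.rpow_natCast]
    norm_num
    ring
  have hs : 0 < Real.sqrt x := Real.sqrt_pos.2 hx0
  have hlog : Real.log x = 2 * Real.log (Real.sqrt x) := by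
    rw [Real.log_sqrt hx0.le]
    ring
  constructor
  · have h2 : (16 : ℝ) ^ 2 ^ (J + 1) ≤ Real.sqrt x := by
      rw [← Real.log_le_log_iff (by positivity) hs, Real.log_pow]
      have h3 : Real.log 16 ≤ 4 := by
        rw [show (16 : ℝ) = 2 ^ 4 by norm_num, Real.log_pow]
        have := Real.log_two_lt_d9
        push_cast
        linarith
      have h4 := mul_le_mul_of_nonneg_left h3 (by positivity : (0 : ℝ) ≤ 2 ^ (J + 1))
      push_cast
      rw [pow_succ] at h4 ⊢
      linarith
    have h5 : 1 / lowerFrac J ^ 2 ≤ Real.sqrt x := by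
      refine le_trans ?_ h2
      rw [lowerFrac, mul_pow, ← pow_mul, ← pow_succ, one_div_pow, mul_one_div, one_div_div]
      exact div_le_self (by positivity) (by norm_num)
    calc Real.sqrt x / lowerFrac J ^ 2 = Real.sqrt x * (1 / lowerFrac J ^ 2) := by
          rw [mul_one_div]
      _ ≤ Real.sqrt x * Real.sqrt x := mul_le_mul_of_nonneg_left h5 hs.le
      _ = x := Real.mul_self_sqrt hx0.le
  · have h2 : (J : ℝ) ≤ 2 ^ J := by exact_mod_cast (Nat.lt_two_pow_self (n := J)).le
    have h3 := Real.log_le_sub_one_of_pos hs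
    have h4 : (0 : ℝ) < 2 ^ J := by positivity
    linarith

theorem tendsto_loglog_div :
    Tendsto (fun n : ℕ => Real.log (Real.log ((n : ℝ) + 1)) / Real.log 2) atTop atTop := by
  refine Tendsto.atTop_div_const (Real.log_pos (by norm_num)) ?_
  exact (Real.tendsto_log_atTop.comp Real.tendsto_log_atTop).comp
    (tendsto_atTop_add_const_right _ 1 tendsto_natCast_atTop_atTop)

/-- The lower bounds are used with `N = √m` at time `m`, for a level `J` with
`16 ^ 2 ^ (J + 1) ≤ √m`. -/
theorem eventually_lower_bound {ε : ℝ} (hε : 0 < ε) :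
    ∀ᶠ n : ℕ in atTop, killedProb Condition.all n
      {T | ¬ Real.log (Real.log ((n : ℝ) + 1)) / Real.log 2 - 4 ≤ T.maxDeg} ≤ ε := by
  have h1 : Tendsto (fun n : ℕ => 2 * (Real.sqrt ((n : ℝ) + 1) ^ 1 *
      Real.exp (-Real.sqrt ((n : ℝ) + 1)))) atTop (𝓝 (2 * 0)) :=
    (((Real.tendsto_pow_mul_exp_neg_atTop_nhds_zero 1).comp Real.tendsto_sqrt_atTop).comp
      (tendsto_atTop_add_const_right _ 1 tendsto_natCast_atTop_atTop)).const_mul 2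
  rw [mul_zero] at h1
  filter_upwards [h1.eventually (gt_mem_nhds hε), tendsto_loglog_div.eventually_ge_atTop 4,
    eventually_ge_atTop 1] with n hn hx hn1
  obtain ⟨x, hxdef⟩ : ∃ x, x = Real.log (Real.log ((n : ℝ) + 1)) / Real.log 2 := ⟨_, rfl⟩
  have hn2 : (1 : ℝ) ≤ n := by exact_mod_cast hn1
  rw [← hxdef] at hx ⊢
  have hfl : 4 ≤ ⌊x⌋₊ := Nat.le_floor (by exact_mod_cast hx)
  obtain ⟨J, hJ⟩ : ∃ J, ⌊x⌋₊ = J + 4 := ⟨⌊x⌋₊ - 4, by omega⟩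
  have hJx : (J : ℝ) + 4 ≤ x := by
    have := Nat.floor_le (by linarith : 0 ≤ x)
    rw [hJ] at this
    exact_mod_cast this
  have hxJ : x < J + 4 + 1 := by
    have := Nat.lt_floor_add_one x
    rw [hJ] at this
    exact_mod_cast this
  rw [hxdef] at hJx
  obtain ⟨h2, h3⟩ := sqrt_div_lowerFrac_sq_le (by linarith : 1 < (n : ℝ) + 1) hJx
  have h4 : 1 ≤ Real.sqrt ((n : ℝ) + 1) := Real.one_le_sqrt.2 (by linarith)
  have hsub : {T : LabelledTree (n + 1) | ¬ x - 4 ≤ T.maxDeg} ⊆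
      {T | ¬ 0 < T.tailDeg (1 + J)} := by
    intro T hT hpos
    rw [T.tailDeg_pos_iff (by omega)] at hpos
    have h5 : ((1 + J : ℕ) : ℝ) ≤ T.maxDeg := by exact_mod_cast hpos
    push_cast at h5
    refine hT ?_
    linarith
  refine ((killedProb_mono n hsub).trans (killedProb_tailDeg_eq_zero_le h4 J n h2)).trans ?_
  have h6 := mul_le_mul_of_nonneg_right h3 (Real.exp_pos (-Real.sqrt ((n : ℝ) + 1))).le
  rw [pow_one, ← mul_assoc] at hn
  linarith

theorem eventually_upper_bound {ε : ℝ} (hε : 0 < ε) :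
    ∀ᶠ n : ℕ in atTop, killedProb Condition.all n
      {T | ¬ (T.maxDeg : ℝ) ≤ Real.log (Real.log ((n : ℝ) + 1)) / Real.log 2 + 11} ≤ ε := by
  obtain ⟨J₀, hJ₀⟩ := exists_upper_bound hε
  filter_upwards [tendsto_loglog_div.eventually_ge_atTop (max 0 (J₀ : ℝ)),
    eventually_ge_atTop 1] with n hx hn1
  obtain ⟨x, hxdef⟩ : ∃ x, x = Real.log (Real.log ((n : ℝ) + 1)) / Real.log 2 := ⟨_, rfl⟩
  have hn2 : (1 : ℝ) ≤ n := by exact_mod_cast hn1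
  rw [← hxdef] at hx ⊢
  have hx0 : 0 ≤ x := (le_max_left _ _).trans hx
  have hxJ₀ : (J₀ : ℝ) ≤ x := (le_max_right _ _).trans hx
  have hceil := Nat.le_ceil x
  have hJ : J₀ ≤ ⌈x⌉₊ + 1 := by
    have : (J₀ : ℝ) ≤ ⌈x⌉₊ := hxJ₀.trans hceil
    have : J₀ ≤ ⌈x⌉₊ := by exact_mod_cast this
    omega
  have h1 := hJ₀ (⌈x⌉₊ + 1) hJ n (le_two_pow_two_pow (by linarith) (by
    rw [← hxdef]
    push_cast
    linarith))
  refine le_trans (killedProb_mono n fun T hT => ?_) h1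
  by_contra hneg
  apply hT
  have h2 : ¬ 9 + (⌈x⌉₊ + 1) + 1 ≤ T.maxDeg := by
    rw [← T.tailDeg_pos_iff (by omega)]
    exact hneg
  have h3 : (T.maxDeg : ℝ) ≤ ((9 + (⌈x⌉₊ + 1) : ℕ) : ℝ) := by
    exact_mod_cast (by omega : T.maxDeg ≤ 9 + (⌈x⌉₊ + 1))
  have h4 := Nat.ceil_lt_add_one hx0
  push_cast at h3
  linarith

theorem killedProb_all_le_one (n : ℕ) (A : Set (LabelledTree (n + 1))) :
    killedProb Condition.all n A ≤ 1 :=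
  killedExp_le_of_le n zero_le_one fun T => Set.indicator_le_self' (fun _ _ => zero_le_one) T

theorem tendsto_killedProb_maxDeg :
    Tendsto (fun n : ℕ => killedProb Condition.all n
      {T | |(T.maxDeg : ℝ) - Real.log (Real.log ((n : ℝ) + 1)) / Real.log 2| ≤ 11})
      atTop (𝓝 1) := by
  rw [Metric.tendsto_atTop']
  intro ε hε
  have h : ∀ᶠ n : ℕ in atTop, dist (killedProb Condition.all n
      {T | |(T.maxDeg : ℝ) - Real.log (Real.log ((n : ℝ) + 1)) / Real.log 2| ≤ 11}) 1 < ε := by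
    filter_upwards [eventually_lower_bound (by positivity : 0 < ε / 3),
      eventually_upper_bound (by positivity : 0 < ε / 3)] with n hlow hup
    obtain ⟨x, hx⟩ : ∃ x, x = Real.log (Real.log ((n : ℝ) + 1)) / Real.log 2 := ⟨_, rfl⟩
    rw [← hx] at hlow hup ⊢
    have h1 : killedProb Condition.all n Set.univ ≤ killedProb Condition.all n
        ({T | |(T.maxDeg : ℝ) - x| ≤ 11} ∪
          ({T | ¬ x - 4 ≤ T.maxDeg} ∪ {T | ¬ (T.maxDeg : ℝ) ≤ x + 11})) := by
      refine killedProb_mono n fun T _ => ?_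
      by_cases h2 : x - 4 ≤ T.maxDeg
      · by_cases h3 : (T.maxDeg : ℝ) ≤ x + 11
        · have h4 : |(T.maxDeg : ℝ) - x| ≤ 11 := abs_le.2 ⟨by linarith, by linarith⟩
          exact Or.inl h4
        · exact Or.inr (Or.inr h3)
      · exact Or.inr (Or.inl h2)
    rw [killedProb_all_univ] at h1
    have h2 := h1.trans (killedProb_union_le n _ _)
    have h3 := killedProb_union_le (G := Condition.all) n {T | ¬ x - 4 ≤ T.maxDeg}
      {T | ¬ (T.maxDeg : ℝ) ≤ x + 11}
    have h4 := killedProb_all_le_one n {T | |(T.maxDeg : ℝ) - x| ≤ 11}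
    rw [Real.dist_eq, abs_lt]
    constructor <;> linarith
  obtain ⟨N, hN⟩ := eventually_atTop.1 h
  exact ⟨N, fun n hn => hN n hn.le⟩

end MinChoice

theorem theorem1p1 :
    ∃ C : ℝ, Tendsto
      (fun m : ℕ => (MinChoice.law m).toOuterMeasure
        {T : MinChoice.LabelledTree m |
          |(T.maxDeg : ℝ) - Real.log (Real.log (m : ℝ)) / Real.log 2| ≤ C})
      atTop (𝓝 1) := by
  refine ⟨11, (tendsto_add_atTop_iff_nat 1).1 ?_⟩
  simp_rw [MinChoice.toOuterMeasure_law]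
  rw [← ENNReal.ofReal_one]
  refine ENNReal.tendsto_ofReal ?_
  push_cast
  exact MinChoice.tendsto_killedProb_maxDeg
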